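/- Notation. For $w:(0,\infty)\to\mathbb R$ integrable on $(0,t)$ for every $t>0$, put $Pw(t)=\frac1t\int_0^t w(s)\,ds$. Let $W$ be the set of such $w$ with $\|w\|_W:=\|Pw-w\|_{L^\infty(0,\infty)}<\infty$. A Banach pair $\overline H=(H_0,H_1)$ consists of two Banach spaces continuously embedded in a common Hausdorff topological vector space; for $x\in H_0\cap H_1$ and $t>0$ put $J(t,x)=\max\{\|x\|_{H_0},t\|x\|_{H_1}\}$. For $0<\theta<1$ and $1\le q\le\infty$ put $\Phi_{\theta,q}(g)=\left(\int_0^\infty (s^{-\theta}|g(s)|)^q\frac{ds}{s}\right)^{1/q}$ (an essential supremum if $q=\infty$). The space $\overline H_{\theta,q}$ consists of all $f\in H_0+H_1$ that can be written $f=\int_0^\infty v(s)\frac{ds}{s}$, as an integral converging in $H_0+H_1$, with $v:(0,\infty)\to H_0\cap H_1$ measurable and $\Phi_{\theta,q}(J(s,v(s)))<\infty$; $\|f\|_{\theta,q}$ is the infimum of $\Phi_{\theta,q}(J(s,v(s)))$ over all such representations. All vector-valued integrals below are taken in $H_0+H_1$. Theorem. Let $0<\theta<1$, $1\le q\le\infty$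 and let $n\ge 0$ be an integer. There is a constant $c$, depending only on $\theta,q,n$, such that the following holds for every Banach pair $\overline H$, every $w\in W$, every measurable $u:(0,\infty)\to H_0\cap H_1$ with $\Phi_{\theta,q}(J(t,u(t)))<\infty$, and every $f\in H_0+H_1$. (i) If $f=\int_0^\infty u(s)\,(Pw(s))^n\frac{ds}{s}$ and $$\int_0^\infty u(s)\,w(s)^k\frac{ds}{s}=0,\qquad \int_0^\infty u(s)\,(Pw(s))^k\frac{ds}{s}=0\qquad (k=0,\dots,n-1),$$ then $f\in\overline H_{\theta,q}$ and $\|f\|_{\theta,q}\le c\,\|w\|_W^n\,\Phi_{\theta,q}(J(t,u(t)))$. (ii) If $f=\int_0^\infty u(s)\,w(s)^n\frac{ds}{s}$, if $$\int_0^\infty u(s)\,w(s)^k\frac{ds}{s}=0,\qquad \int_0^\infty u(s)\,(Pw(s))^k\frac{ds}{s}=0\qquad (k=0,\dots,n-1),$$ and if at least one of the following two mixed moment conditions holds: (a) $\int_0^\infty u(s)\,w(s)^{n-k}(Pw(s))^k\frac{ds}{s}=0$ for $k=1,\dots,n-1$; (b) $\int_0^\infty u(s)\,w(s)^{m-k}(Pw(s))^k\frac{ds}{s}=0$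 for all $0\le k\le m\le n-1$, then $f\in\overline H_{\theta,q}$ and $\|f\|_{\theta,q}\le c\,\|w\|_W^n\,\Phi_{\theta,q}(J(t,u(t)))$. -/

import Mathlib

open MeasureTheory Set
open scoped ENNReal NNReal

noncomputable section

namespace JMethod

/-- The measure `ds/s` on `(0,∞)`. -/
def haarPos : Measure ℝ :=
  (volume.restrict (Ioi (0 : ℝ))).withDensity fun s => ENNReal.ofReal s⁻¹

/-! ### The space `W` -/

/-- The averaging operator `Pw(t) = (1/t) ∫₀ᵗ w(s) ds`. -/
def avg (w : ℝ → ℝ) (t : ℝ) : ℝ := t⁻¹ * ∫ s in (0 : ℝ)..t, w s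

/-- The oscillation `w^#(t) = Pw(t) - w(t)`. -/
def osc (w : ℝ → ℝ) (t : ℝ) : ℝ := avg w t - w t

/-- `w ∈ W`: the averages `Pw(t)`, `t > 0`, are defined (as Lebesgue integrals) and
`w^# ∈ L^∞(0,∞)`. Only the values of `w` on `(0,∞)` matter. -/
def MemW (w : ℝ → ℝ) : Prop :=
  (∀ t : ℝ, 0 < t → IntegrableOn w (Ioc 0 t)) ∧ MemLp (osc w) ∞ (volume.restrict (Ioi (0 : ℝ)))

/-- `‖w‖_W = ‖Pw - w‖_{L^∞(0,∞)}`. -/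
def normW (w : ℝ → ℝ) : ℝ≥0∞ := eLpNorm (osc w) ∞ (volume.restrict (Ioi (0 : ℝ)))

/-! ### Banach pairs -/

/-- A compatible pair of Banach spaces: `X₀` and `X₁` are continuously embedded in a common
Hausdorff topological vector space `E`. -/
structure BanachPair (E X₀ X₁ : Type*)
    [AddCommGroup E] [Module ℝ E] [TopologicalSpace E] [IsTopologicalAddGroup E]
    [ContinuousSMul ℝ E] [T2Space E]
    [NormedAddCommGroup X₀] [NormedSpace ℝ X₀] [CompleteSpace X₀]
    [NormedAddCommGroup X₁] [NormedSpace ℝ X₁] [CompleteSpace X₁] where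
  /-- the embedding of `X₀` -/
  ι₀ : X₀ →L[ℝ] E
  /-- the embedding of `X₁` -/
  ι₁ : X₁ →L[ℝ] E
  inj₀ : Function.Injective ι₀
  inj₁ : Function.Injective ι₁

namespace BanachPair

variable {E X₀ X₁ : Type*}
  [AddCommGroup E] [Module ℝ E] [TopologicalSpace E] [IsTopologicalAddGroup E]
  [ContinuousSMul ℝ E] [T2Space E]
  [NormedAddCommGroup X₀] [NormedSpace ℝ X₀] [CompleteSpace X₀]
  [NormedAddCommGroup X₁] [NormedSpace ℝ X₁] [CompleteSpace X₁]

/-- The pairs `(x₀, x₁)` whose two entries are the same element of `E`. -/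
def interSubmodule (H : BanachPair E X₀ X₁) : Submodule ℝ (X₀ × X₁) :=
  LinearMap.ker ((H.ι₀.comp (ContinuousLinearMap.fst ℝ X₀ X₁)
    - H.ι₁.comp (ContinuousLinearMap.snd ℝ X₀ X₁) : X₀ × X₁ →L[ℝ] E) : X₀ × X₁ →ₗ[ℝ] E)

/-- The intersection `X₀ ∩ X₁`, with the norm `max (‖x‖_{X₀}) (‖x‖_{X₁})`: an element is stored
together with its two incarnations in `X₀` and in `X₁`. -/
abbrev Inter (H : BanachPair E X₀ X₁) : Type _ := H.interSubmodule

/-- The map `(x₀, x₁) ↦ x₀ + x₁ ∈ E` on `X₀ × X₁`, where the product has the norm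
`‖x₀‖ + ‖x₁‖`. -/
def addMap (H : BanachPair E X₀ X₁) : WithLp 1 (X₀ × X₁) →L[ℝ] E :=
  (H.ι₀.coprod H.ι₁).comp
    (WithLp.prodContinuousLinearEquiv 1 ℝ X₀ X₁ : WithLp 1 (X₀ × X₁) →L[ℝ] X₀ × X₁)

/-- The pairs `(x₀, x₁)` with `x₀ + x₁ = 0` in `E`. -/
def sumKer (H : BanachPair E X₀ X₁) : Submodule ℝ (WithLp 1 (X₀ × X₁)) :=
  LinearMap.ker (H.addMap : WithLp 1 (X₀ × X₁) →ₗ[ℝ] E)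

instance isClosed_sumKer (H : BanachPair E X₀ X₁) :
    IsClosed (H.sumKer : Set (WithLp 1 (X₀ × X₁))) :=
  H.addMap.isClosed_ker

/-- The sum `X₀ + X₁`, with the norm `inf {‖x₀‖ + ‖x₁‖ : f = x₀ + x₁}`, realised as the quotient of
`X₀ × X₁` by the kernel of the addition map into `E`. -/
abbrev Sum (H : BanachPair E X₀ X₁) : Type _ := WithLp 1 (X₀ × X₁) ⧸ H.sumKer

instance completeSpace_sum (H : BanachPair E X₀ X₁) : CompleteSpace H.Sum :=
  inferInstance

/-- The inclusion `X₀ ∩ X₁ → X₀ + X₁`. -/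
def toSum (H : BanachPair E X₀ X₁) (x : H.Inter) : H.Sum :=
  H.sumKer.mkQ (WithLp.toLp 1 (x.1.1, 0))

/-- `J(t, x) = max {‖x‖_{X₀}, t ‖x‖_{X₁}}`. -/
def J (H : BanachPair E X₀ X₁) (t : ℝ) (x : H.Inter) : ℝ := max ‖x.1.1‖ (t * ‖x.1.2‖)

/-- `f = ∫₀^∞ u(s) ds/s` in `X₀ + X₁`, for a measurable `u : (0,∞) → X₀ ∩ X₁`. -/
def HasIntegral (H : BanachPair E X₀ X₁) (u : ℝ → H.Inter) (f : H.Sum) : Prop :=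
  AEStronglyMeasurable u haarPos ∧ Integrable (fun s => H.toSum (u s)) haarPos ∧
    ∫ s, H.toSum (u s) ∂haarPos = f

/-- `Φ_{θ,q}(g) = (∫₀^∞ (s^{-θ} |g(s)|)^q ds/s)^{1/q}` (an essential supremum for `q = ∞`). -/
def _root_.JMethod.Phi (θ : ℝ) (q : ℝ≥0∞) (g : ℝ → ℝ) : ℝ≥0∞ :=
  eLpNorm (fun s => s ^ (-θ) * g s) q haarPos

/-- `Φ_{θ,q}(J(s, u(s)))`. -/
def PhiJ (H : BanachPair E X₀ X₁) (θ : ℝ) (q : ℝ≥0∞) (u : ℝ → H.Inter) : ℝ≥0∞ :=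
  Phi θ q fun s => H.J s (u s)

/-- Membership of `f ∈ X₀ + X₁` in the real interpolation space `(X₀, X₁)_{θ,q}`. -/
def MemInterp (H : BanachPair E X₀ X₁) (θ : ℝ) (q : ℝ≥0∞) (f : H.Sum) : Prop :=
  ∃ u : ℝ → H.Inter, H.HasIntegral u f ∧ H.PhiJ θ q u < ∞

/-- The norm of the real interpolation space `(X₀, X₁)_{θ,q}`: the infimum of `Φ_{θ,q}(J(s, u(s)))`
over the representations `f = ∫₀^∞ u(s) ds/s`. -/
def normInterp (H : BanachPair E X₀ X₁) (θ : ℝ) (q : ℝ≥0∞) (f : H.Sum) : ℝ≥0∞ :=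
  ⨅ (u : ℝ → H.Inter) (_ : H.HasIntegral u f), H.PhiJ θ q u

end BanachPair

end JMethod

end

noncomputable section

namespace JMethod

/-! ### Logarithmic coordinates -/

/-! Substitute `s = exp x`, so that `ds/s` becomes Lebesgue measure, and put `v x = u (exp x)`, `p x
= Pw (exp x)`, `b x = w^# (exp x)`. Since `(t Pw)' = w` almost everywhere, `p' = -b` with `|b| ≤ B =
‖w‖_W`, and `w (exp x) = p x - b x`. Thus `p` grows at most linearly, while `v x` decays
exponentially in `H₀ + H₁` on average, so all moments converge absolutely.

If `∫ v = 0`, the primitive `V x = ∫_{y ≤ x} v = -∫_{y > x} v` takes values in `H₀ ∩ H₁`: the first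
expression converges in `H₀`, the second in `H₁`. Its weighted `J`-functional is at most that of `v`
convolved with `exp (-a |x|)`, `a = min θ (1 - θ)`, so passing from `v` to `V` costs in `L^q` the
mass `A` of this kernel (`eLpNorm_logJ_primitive_le`). Integration by parts gives `∫ p^k b V = (k +
1)⁻¹ ∫ p^(k+1) v` (`exists_integral_pow_smul_primitive`). Hence `n b V` has vanishing `p`-moments
below order `n - 1`, and its moment of order `n - 1` is the `n`-th moment of `v`. Iterating
represents `∫ p^n v` with bound `n! A^n B^n`, which is (i) (`hasRepr_integral_pow_smul`).

For (ii)(a), expand `(-b)^n = ((p - b) - p)^n`: only the two pure powers survive, `(-b)^n v` is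
itself an admissible density, and the `p^n` term is (i). For (ii)(b), expand `(p - b)^n` in powers
of `p` and `-b`, and apply (i) at order `n - m` to each `(-b)^m v`; its lower moments are
combinations of mixed moments of degree below `n`. -/

theorem measurableEmbedding_exp : MeasurableEmbedding Real.exp :=
  Real.isOpenEmbedding_exp.measurableEmbedding

theorem haarPos_eq_map_exp : haarPos = Measure.map Real.exp volume := by
  ext s hs
  rw [haarPos, withDensity_apply _ hs, Measure.restrict_restrict hs,
    Measure.map_apply Real.measurable_exp hs]
  have himg : s ∩ Ioi 0 = Real.exp '' (Real.exp ⁻¹' s) := by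
    rw [image_preimage_eq_inter_range, Real.range_exp]
  rw [himg, lintegral_image_eq_lintegral_abs_deriv_mul (Real.measurable_exp hs)
    (fun x _ => (Real.hasDerivAt_exp x).hasDerivWithinAt) (Real.exp_injective.injOn)]
  have : ∀ x, ENNReal.ofReal |Real.exp x| * ENNReal.ofReal (Real.exp x)⁻¹ = 1 := fun x => by
    rw [← ENNReal.ofReal_mul (abs_nonneg _), abs_of_pos (Real.exp_pos x),
      mul_inv_cancel₀ (Real.exp_pos x).ne', ENNReal.ofReal_one]
  simp_rw [this]
  simp

/-! ### An exponential kernel on the line -/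

/-- The kernel `exp (-a |x - y|)`. -/
def expKernel (a x y : ℝ) : ℝ≥0∞ := ENNReal.ofReal (Real.exp (-a * |x - y|))

theorem expKernel_comm (a x y : ℝ) : expKernel a x y = expKernel a y x := by
  simp only [expKernel, abs_sub_comm]

theorem expKernel_le_one {a : ℝ} (ha : 0 ≤ a) (x y : ℝ) : expKernel a x y ≤ 1 := by
  rw [expKernel, ENNReal.ofReal_le_one, Real.exp_le_one_iff]
  have := mul_nonneg ha (abs_nonneg (x - y))
  linarith

theorem measurable_expKernel (a : ℝ) : Measurable fun z : ℝ × ℝ => expKernel a z.1 z.2 := by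
  unfold expKernel
  fun_prop

theorem integrable_exp_neg_mul_abs {a : ℝ} (ha : 0 < a) :
    Integrable fun x : ℝ => Real.exp (-a * |x|) := by
  rw [← integrableOn_univ, ← Iic_union_Ioi (a := (0 : ℝ))]
  refine IntegrableOn.union ?_ ?_
  · refine (integrableOn_exp_mul_Iic ha 0).congr_fun (fun x hx => ?_) measurableSet_Iic
    simp [abs_of_nonpos (mem_Iic.1 hx)]
  · refine (integrableOn_exp_mul_Ioi (neg_lt_zero.2 ha) 0).congr_fun (fun x hx => ?_)
      measurableSet_Ioi
    simp [abs_of_pos (mem_Ioi.1 hx)]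

/-- The mass of the kernel `exp (-a |x - y|)`. -/
def expKernelMass (a : ℝ) : ℝ≥0∞ := ∫⁻ x : ℝ, ENNReal.ofReal (Real.exp (-a * |x|))

theorem expKernelMass_lt_top {a : ℝ} (ha : 0 < a) : expKernelMass a < ∞ :=
  (integrable_exp_neg_mul_abs ha).lintegral_lt_top

theorem lintegral_expKernel (a x : ℝ) : ∫⁻ y, expKernel a x y = expKernelMass a :=
  lintegral_sub_left_eq_self (fun z => ENNReal.ofReal (Real.exp (-a * |z|))) x

/-- The operator with kernel `exp (-a |x - y|)`, applied to `|g|`. -/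
def expConv (a : ℝ) (g : ℝ → ℝ) (x : ℝ) : ℝ≥0∞ := ∫⁻ y, expKernel a x y * ‖g y‖ₑ

theorem measurable_expKernel_right (a x : ℝ) : Measurable (expKernel a x) :=
  (measurable_expKernel a).comp measurable_prodMk_left

theorem withDensity_expKernel_le {a : ℝ} (ha : 0 ≤ a) (x : ℝ) :
    (volume : Measure ℝ).withDensity (expKernel a x) ≤ volume := by
  refine (withDensity_mono (Filter.Eventually.of_forall (expKernel_le_one ha x))).trans ?_
  exact (withDensity_one (μ := (volume : Measure ℝ))).le

/-- Hölder's inequality for the measure with density `expKernel a x`, whose total mass is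
`expKernelMass a`. -/
theorem expConv_le {a : ℝ} (ha : 0 ≤ a) {q : ℝ≥0∞} (hq : 1 ≤ q) {g : ℝ → ℝ}
    (hg : AEStronglyMeasurable g) (x : ℝ) :
    expConv a g x ≤ eLpNorm g q ((volume : Measure ℝ).withDensity (expKernel a x)) *
      expKernelMass a ^ (1 - 1 / q.toReal) := by
  have h := eLpNorm_le_eLpNorm_mul_rpow_measure_univ hq
    (hg.mono_measure (withDensity_expKernel_le ha x))
  rw [withDensity_apply _ MeasurableSet.univ, Measure.restrict_univ, lintegral_expKernel,
    eLpNorm_one_eq_lintegral_enorm, lintegral_withDensity_eq_lintegral_mul₀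
      (measurable_expKernel_right a x).aemeasurable hg.enorm] at h
  simpa [expConv] using h

theorem expConv_lt_top {a : ℝ} (ha : 0 < a) {q : ℝ≥0∞} (hq : 1 ≤ q) {g : ℝ → ℝ}
    (hg : MemLp g q) (x : ℝ) : expConv a g x < ∞ := by
  refine (expConv_le ha.le hq hg.1 x).trans_lt (ENNReal.mul_lt_top ?_ ?_)
  · exact (eLpNorm_mono_measure g (withDensity_expKernel_le ha.le x)).trans_lt hg.2
  · refine ENNReal.rpow_lt_top_of_nonneg ?_ (expKernelMass_lt_top ha).ne
    rcases eq_or_ne q ∞ with rfl | hq'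
    · simp
    · have : 1 ≤ q.toReal := by simpa using ENNReal.toReal_mono hq' hq
      rw [sub_nonneg]
      exact (div_le_one (by linarith)).2 this

/-- Schur's test for the kernel `exp (-a |x - y|)`. -/
theorem eLpNorm_le_of_le_expConv {a : ℝ} (ha : 0 < a) {q : ℝ≥0∞} (hq : 1 ≤ q) {g h : ℝ → ℝ}
    (hg : AEStronglyMeasurable g) (hh : ∀ x, ‖h x‖ₑ ≤ expConv a g x) :
    eLpNorm h q ≤ expKernelMass a * eLpNorm g q := by
  rcases eq_or_ne q ∞ with rfl | hq'
  · rw [eLpNorm_exponent_top]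
    refine eLpNormEssSup_le_of_ae_enorm_bound (Filter.Eventually.of_forall fun x => ?_)
    refine (hh x).trans ((expConv_le ha.le hq hg x).trans ?_)
    -- `∞.toReal = 0` and `1 / 0 = 0`, so the exponent `1 - 1 / q.toReal` is 1, the correct value at
    -- `q = ∞`.
    simp only [ENNReal.toReal_top, div_zero, sub_zero, ENNReal.rpow_one]
    rw [mul_comm]
    gcongr
    exact withDensity_expKernel_le ha.le x
  have hr : 1 ≤ q.toReal := by simpa using ENNReal.toReal_mono hq' hq
  have hr0 : 0 < q.toReal := by linarith
  have hq0 : q ≠ 0 := (zero_lt_one.trans_le hq).ne'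
  set r := q.toReal with hrdef
  set A := expKernelMass a
  have hgr : AEMeasurable fun y => ‖g y‖ₑ ^ r := hg.enorm.pow_const r
  have hpt : ∀ x, ‖h x‖ₑ ^ r ≤ A ^ (r - 1) * ∫⁻ y, expKernel a x y * ‖g y‖ₑ ^ r := by
    intro x
    calc ‖h x‖ₑ ^ r ≤ (eLpNorm g q ((volume : Measure ℝ).withDensity (expKernel a x)) *
          A ^ (1 - 1 / r)) ^ r := by
          gcongr
          exact (hh x).trans (expConv_le ha.le hq hg x)
      _ = A ^ (r - 1) * ∫⁻ y, expKernel a x y * ‖g y‖ₑ ^ r := by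
          rw [ENNReal.mul_rpow_of_nonneg _ _ hr0.le, ← ENNReal.rpow_mul, mul_comm,
            eLpNorm_eq_lintegral_rpow_enorm_toReal hq0 hq', ← ENNReal.rpow_mul, ← hrdef,
            one_div_mul_cancel hr0.ne', ENNReal.rpow_one,
            lintegral_withDensity_eq_lintegral_mul₀ (measurable_expKernel_right a x).aemeasurable hgr,
            sub_mul, one_div_mul_cancel hr0.ne', one_mul]
          rfl
  rw [eLpNorm_eq_lintegral_rpow_enorm_toReal hq0 hq', eLpNorm_eq_lintegral_rpow_enorm_toReal hq0 hq',
    ← hrdef]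
  have hA : A = (A ^ r) ^ (1 / r) := by
    rw [← ENNReal.rpow_mul, mul_one_div_cancel hr0.ne', ENNReal.rpow_one]
  rw [hA, ← ENNReal.mul_rpow_of_nonneg _ _ (by positivity)]
  gcongr
  have hmeas : AEMeasurable (fun z : ℝ × ℝ => expKernel a z.1 z.2 * ‖g z.2‖ₑ ^ r)
      (volume.prod volume) :=
    (measurable_expKernel a).aemeasurable.mul hgr.comp_snd
  -- Hölder in `y` has produced `A ^ (r - 1)`; Tonelli and the symmetry of the kernel supply the
  -- last factor `A`.
  calc ∫⁻ x, ‖h x‖ₑ ^ r ≤ ∫⁻ x, A ^ (r - 1) * ∫⁻ y, expKernel a x y * ‖g y‖ₑ ^ r :=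
        lintegral_mono hpt
    _ = A ^ (r - 1) * ∫⁻ x, ∫⁻ y, expKernel a x y * ‖g y‖ₑ ^ r :=
        lintegral_const_mul'' _ hmeas.lintegral_prod_right'
    _ = A ^ (r - 1) * ∫⁻ y, ∫⁻ x, expKernel a x y * ‖g y‖ₑ ^ r := by
        rw [lintegral_lintegral_swap hmeas]
    _ = A ^ (r - 1) * ∫⁻ y, A * ‖g y‖ₑ ^ r := by
        congr 2 with y
        simp_rw [fun x => expKernel_comm a x y]
        rw [lintegral_mul_const _ (measurable_expKernel_right a y), lintegral_expKernel]
    _ = A ^ r * ∫⁻ y, ‖g y‖ₑ ^ r := by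
        rw [lintegral_const_mul'' _ hgr, ← mul_assoc]
        congr 1
        have hA' : A ^ (r - 1) * A ^ (1 : ℝ) = A ^ r := by
          rw [← ENNReal.rpow_add_of_nonneg _ _ (by linarith) zero_le_one, sub_add_cancel]
        rwa [ENNReal.rpow_one] at hA'

/-! ### The profile of `w` in logarithmic coordinates -/

/-- `p` is locally absolutely continuous with derivative `-b`, and `|b| ≤ B` almost everywhere. -/
structure IsProfile (p b : ℝ → ℝ) (B : ℝ) : Prop where
  nonneg : 0 ≤ B
  continuous : Continuous p
  aestronglyMeasurable : AEStronglyMeasurable b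
  bound : ∀ᵐ x, |b x| ≤ B
  -- The relation `p' = -b` in the integrated form needed for integration by parts; `k = 0` also
  -- yields the linear growth of `p`.
  pow_succ_sub : ∀ (k : ℕ) (x : ℝ),
    ∫ y in (0 : ℝ)..x, p y ^ k * b y = -((k + 1 : ℝ)⁻¹ * (p x ^ (k + 1) - p 0 ^ (k + 1)))

theorem IsProfile.abs_le {p b : ℝ → ℝ} {B : ℝ} (h : IsProfile p b B) (x : ℝ) :
    |p x| ≤ |p 0| + B * |x| := by
  have h1 := h.pow_succ_sub 0 x
  simp only [pow_zero, one_mul, Nat.cast_zero, zero_add, inv_one, pow_one] at h1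
  have h2 : ‖∫ y in (0 : ℝ)..x, b y‖ ≤ B * |x - 0| :=
    intervalIntegral.norm_integral_le_of_norm_le_const_ae (h.bound.mono fun y hy _ => hy)
  rw [h1, norm_neg, Real.norm_eq_abs, sub_zero] at h2
  have h3 := abs_sub_abs_le_abs_sub (p x) (p 0)
  linarith

theorem absolutelyContinuousOnInterval_pow {f : ℝ → ℝ} {a b : ℝ}
    (hf : AbsolutelyContinuousOnInterval f a b) (k : ℕ) :
    AbsolutelyContinuousOnInterval (fun x => f x ^ k) a b := by
  induction k with
  | zero =>
    simp only [pow_zero]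
    exact (contDiff_const (c := (1 : ℝ)) (n := 1)).contDiffOn.absolutelyContinuousOnInterval
  | succ k ih =>
    simp only [pow_succ]
    exact ih.fun_mul hf

/-- With `h y = exp y * w (exp y)`, `p` is `exp (-x)` times a primitive of `h`, hence locally
absolutely continuous, and the product rule gives `p' = -p + w (exp x) = -b` almost everywhere. The
powers of `p` are then recovered from their derivatives. -/
theorem MemW.isProfile {w : ℝ → ℝ} (hw : MemW w) :
    IsProfile (fun x => avg w (Real.exp x)) (fun x => osc w (Real.exp x)) (normW w).toReal := by
  have himg : ∀ x, Real.exp '' Iic x = Ioc 0 (Real.exp x) := fun x => by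
    ext y
    constructor
    · rintro ⟨z, hz, rfl⟩
      exact ⟨Real.exp_pos z, Real.exp_le_exp.2 hz⟩
    · rintro ⟨hy0, hy⟩
      exact ⟨Real.log y, (Real.log_le_iff_le_exp hy0).2 hy, Real.exp_log hy0⟩
  set h : ℝ → ℝ := fun y => Real.exp y * w (Real.exp y) with hdef
  have hint : ∀ x, IntegrableOn h (Iic x) := fun x => by
    have := hw.1 (Real.exp x) (Real.exp_pos x)
    rw [← himg, integrableOn_image_iff_integrableOn_abs_deriv_smul measurableSet_Iic
      (fun x _ => (Real.hasDerivAt_exp x).hasDerivWithinAt) Real.exp_injective.injOn] at this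
    simpa [abs_of_pos (Real.exp_pos _)] using this
  have hG : ∀ x, ∫ s in (0 : ℝ)..Real.exp x, w s = (∫ y in Iic 0, h y) + ∫ y in (0 : ℝ)..x, h y := by
    intro x
    rw [← intervalIntegral.integral_Iic_sub_Iic (hint 0) (hint x), add_sub_cancel,
      intervalIntegral.integral_of_le (Real.exp_pos x).le, ← himg,
      integral_image_eq_integral_abs_deriv_smul measurableSet_Iic
      (fun x _ => (Real.hasDerivAt_exp x).hasDerivWithinAt) Real.exp_injective.injOn]
    simp [hdef, abs_of_pos (Real.exp_pos _)]
  have hii : ∀ x y, IntervalIntegrable h volume x y := fun x y =>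
    (intervalIntegrable_iff.2 ((hint (max x y)).mono_set fun z hz => (mem_Ioc.1 hz).2))
  set p : ℝ → ℝ := fun x => avg w (Real.exp x) with hp
  have hpG : p = fun x => Real.exp (-x) * ((∫ y in Iic 0, h y) + ∫ y in (0 : ℝ)..x, h y) := by
    funext x
    simp only [hp, avg, hG, Real.exp_neg]
  have hac : ∀ x, AbsolutelyContinuousOnInterval p 0 x := fun x => by
    rw [hpG]
    refine AbsolutelyContinuousOnInterval.fun_mul ?_ (AbsolutelyContinuousOnInterval.fun_add ?_ ?_)
    · exact (Real.contDiff_exp.comp contDiff_neg).contDiffOn.absolutelyContinuousOnInterval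
    · exact contDiff_const.contDiffOn.absolutelyContinuousOnInterval
    · exact (hii 0 x).absolutelyContinuousOnInterval_intervalIntegral left_mem_uIcc
  have hloc : LocallyIntegrable h := by
    rw [locallyIntegrable_iff]
    intro K hK
    obtain ⟨M, hM⟩ := hK.bddAbove
    exact (hint M).mono_set fun z hz => hM hz
  have hderiv : ∀ᵐ x, HasDerivAt p (-osc w (Real.exp x)) x := by
    filter_upwards [LocallyIntegrable.ae_hasDerivAt_integral hloc] with x hx
    have h1 : HasDerivAt (fun x : ℝ => Real.exp (-x)) (-Real.exp (-x)) x := by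
      simpa using (hasDerivAt_neg x).exp
    have h2 := h1.mul ((hx 0).const_add (∫ y in Iic 0, h y))
    have h3 : p x = Real.exp (-x) * ((∫ y in Iic 0, h y) + ∫ y in (0 : ℝ)..x, h y) := by rw [hpG]
    rw [hpG]
    convert! h2 using 1
    have h4 : Real.exp (-x) * h x = w (Real.exp x) := by
      rw [hdef, ← mul_assoc, ← Real.exp_add]; simp
    rw [h4, osc, show avg w (Real.exp x) = p x from rfl, h3]
    ring
  have hcont : Continuous p := by
    rw [hpG]
    exact (Real.continuous_exp.comp continuous_neg).mul
      (continuous_const.add (intervalIntegral.continuous_primitive hii 0))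
  have hmeasw : AEStronglyMeasurable (fun x => w (Real.exp x)) := by
    have : AEStronglyMeasurable (fun x => Real.exp (-x) * h x) :=
      (Real.continuous_exp.comp continuous_neg).aestronglyMeasurable.mul hloc.aestronglyMeasurable
    refine this.congr (Filter.Eventually.of_forall fun x => ?_)
    simp only [hdef, ← mul_assoc, ← Real.exp_add]; simp
  refine ⟨ENNReal.toReal_nonneg, hcont, hcont.aestronglyMeasurable.sub hmeasw, ?_, ?_⟩
  · have h1 : ∀ᵐ t ∂(volume.restrict (Ioi (0 : ℝ))), |osc w t| ≤ (normW w).toReal := by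
      filter_upwards [ae_le_eLpNormEssSup (f := osc w) (μ := volume.restrict (Ioi (0 : ℝ)))] with t ht
      have hfin : normW w ≠ ∞ := hw.2.2.ne
      rw [← eLpNorm_exponent_top] at ht
      simpa using ENNReal.toReal_mono hfin ht
    -- Null sets of `(0,∞)` pull back under `exp` to null sets, because `haarPos` is the image of
    -- Lebesgue measure.
    have h2 : haarPos ≪ volume.restrict (Ioi (0 : ℝ)) := withDensity_absolutelyContinuous _ _
    have h3 := h2.ae_le h1
    rw [haarPos_eq_map_exp] at h3
    exact ae_of_ae_map Real.measurable_exp.aemeasurable h3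
  · intro k x
    have h1 := (absolutelyContinuousOnInterval_pow (hac x) (k + 1)).integral_deriv_eq_sub
    have h2 : ∫ y in (0 : ℝ)..x, deriv (fun x => p x ^ (k + 1)) y =
        ∫ y in (0 : ℝ)..x, -(k + 1 : ℝ) * (p y ^ k * osc w (Real.exp y)) := by
      refine intervalIntegral.integral_congr_ae ?_
      filter_upwards [hderiv] with y hy _
      rw [(hy.fun_pow (k + 1)).deriv]
      push_cast
      ring
    rw [h2, intervalIntegral.integral_const_mul] at h1
    rw [← h1]
    have : (k + 1 : ℝ) ≠ 0 := by positivity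
    field_simp

/-! ### Exponential decay against polynomial growth -/

theorem integrable_exp_mul_of_memLp {a : ℝ} (ha : 0 < a) {q : ℝ≥0∞} (hq : 1 ≤ q) {g : ℝ → ℝ}
    (hg : MemLp g q) (x : ℝ) : Integrable fun y => Real.exp (-a * |x - y|) * g y := by
  refine ⟨AEStronglyMeasurable.mul (by fun_prop) hg.1, ?_⟩
  refine lt_of_eq_of_lt (lintegral_congr fun y => ?_) (expConv_lt_top ha hq hg x)
  rw [enorm_mul, expKernel, Real.enorm_eq_ofReal (Real.exp_pos _).le]

theorem exists_one_add_abs_pow_le (N : ℕ) {a : ℝ} (ha : 0 < a) :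
    ∃ C : ℝ, 0 ≤ C ∧ ∀ x : ℝ, (1 + |x|) ^ N ≤ C * Real.exp (a * |x|) := by
  refine ⟨N.factorial * Real.exp a / a ^ N, by positivity, fun x => ?_⟩
  have h := Real.pow_div_factorial_le_exp (a * (1 + |x|)) (by positivity) N
  rw [div_le_iff₀ (by positivity), mul_pow, mul_add, mul_one, Real.exp_add] at h
  rw [div_mul_eq_mul_div, le_div_iff₀ (by positivity)]
  linarith

namespace BanachPair

variable {E X₀ X₁ : Type*}
  [AddCommGroup E] [Module ℝ E] [TopologicalSpace E] [IsTopologicalAddGroup E]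
  [ContinuousSMul ℝ E] [T2Space E]
  [NormedAddCommGroup X₀] [NormedSpace ℝ X₀] [CompleteSpace X₀]
  [NormedAddCommGroup X₁] [NormedSpace ℝ X₁] [CompleteSpace X₁]

/-! ### The inclusions into the sum -/

/-- The inclusion `X₀ → X₀ + X₁`. -/
def inl (H : BanachPair E X₀ X₁) : X₀ →L[ℝ] H.Sum :=
  H.sumKer.mkQL ∘L ((WithLp.prodContinuousLinearEquiv 1 ℝ X₀ X₁).symm :
    X₀ × X₁ →L[ℝ] WithLp 1 (X₀ × X₁)) ∘L ContinuousLinearMap.inl ℝ X₀ X₁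

/-- The inclusion `X₁ → X₀ + X₁`. -/
def inr (H : BanachPair E X₀ X₁) : X₁ →L[ℝ] H.Sum :=
  H.sumKer.mkQL ∘L ((WithLp.prodContinuousLinearEquiv 1 ℝ X₀ X₁).symm :
    X₀ × X₁ →L[ℝ] WithLp 1 (X₀ × X₁)) ∘L ContinuousLinearMap.inr ℝ X₀ X₁

theorem norm_inl_le (H : BanachPair E X₀ X₁) (x : X₀) : ‖H.inl x‖ ≤ ‖x‖ := by
  refine (Submodule.Quotient.norm_mk_le H.sumKer (WithLp.toLp 1 (x, 0))).trans ?_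
  simp

theorem norm_inr_le (H : BanachPair E X₀ X₁) (x : X₁) : ‖H.inr x‖ ≤ ‖x‖ := by
  refine (Submodule.Quotient.norm_mk_le H.sumKer (WithLp.toLp 1 (0, x))).trans ?_
  simp

theorem mem_interSubmodule_iff (H : BanachPair E X₀ X₁) (x₀ : X₀) (x₁ : X₁) :
    (x₀, x₁) ∈ H.interSubmodule ↔ H.ι₀ x₀ = H.ι₁ x₁ := by
  simp [interSubmodule, sub_eq_zero]

/-- Allows membership in the intersection to be tested by an identity in the sum, where integrals
over complementary half-lines can be added. -/
theorem inl_eq_inr_iff (H : BanachPair E X₀ X₁) (x₀ : X₀) (x₁ : X₁) :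
    H.inl x₀ = H.inr x₁ ↔ (x₀, x₁) ∈ H.interSubmodule := by
  have h : H.inl x₀ = H.inr x₁ ↔
      (WithLp.toLp 1 (x₀, 0) - WithLp.toLp 1 (0, x₁) : WithLp 1 (X₀ × X₁)) ∈ H.sumKer :=
    Submodule.Quotient.eq H.sumKer
  rw [h, mem_interSubmodule_iff]
  simp [sumKer, addMap, ← sub_eq_add_neg, sub_eq_zero]

/-- The inclusion `X₀ ∩ X₁ → X₀ + X₁` as a continuous linear map. -/
def toSumL (H : BanachPair E X₀ X₁) : H.Inter →L[ℝ] H.Sum :=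
  H.inl ∘L ContinuousLinearMap.fst ℝ X₀ X₁ ∘L H.interSubmodule.subtypeL

theorem toSumL_eq_inl (H : BanachPair E X₀ X₁) (z : H.Inter) : H.toSumL z = H.inl z.1.1 := rfl

theorem toSumL_eq_inr (H : BanachPair E X₀ X₁) (z : H.Inter) : H.toSumL z = H.inr z.1.2 :=
  (H.inl_eq_inr_iff _ _).2 z.2

/-! ### The weighted `J`-functional in logarithmic coordinates -/

theorem J_smul (H : BanachPair E X₀ X₁) (t c : ℝ) (z : H.Inter) :
    H.J t (c • z) = |c| * H.J t z := by
  simp only [J, Submodule.coe_smul, Prod.smul_fst, Prod.smul_snd, norm_smul, Real.norm_eq_abs]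
  rw [mul_max_of_nonneg _ _ (abs_nonneg c), mul_left_comm]

theorem J_nonneg (H : BanachPair E X₀ X₁) (t : ℝ) (z : H.Inter) : 0 ≤ H.J t z :=
  (norm_nonneg _).trans (le_max_left _ _)

theorem J_add_le (H : BanachPair E X₀ X₁) {t : ℝ} (ht : 0 ≤ t) (y z : H.Inter) :
    H.J t (y + z) ≤ H.J t y + H.J t z := by
  refine max_le ?_ ?_
  · exact (norm_add_le _ _).trans (add_le_add (le_max_left _ _) (le_max_left _ _))
  · refine (mul_le_mul_of_nonneg_left (norm_add_le _ _) ht).trans ?_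
    rw [mul_add]
    exact add_le_add (le_max_right _ _) (le_max_right _ _)

/-- `exp (-θ x) J(exp x, v x)`. -/
def logJ (H : BanachPair E X₀ X₁) (θ : ℝ) (v : ℝ → H.Inter) (x : ℝ) : ℝ :=
  Real.exp (-θ * x) * H.J (Real.exp x) (v x)

theorem logJ_nonneg (H : BanachPair E X₀ X₁) (θ : ℝ) (v : ℝ → H.Inter) (x : ℝ) :
    0 ≤ H.logJ θ v x :=
  mul_nonneg (Real.exp_pos _).le (H.J_nonneg _ _)

theorem logJ_smul (H : BanachPair E X₀ X₁) (θ : ℝ) (c : ℝ → ℝ) (v : ℝ → H.Inter) (x : ℝ) :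
    H.logJ θ (fun x => c x • v x) x = |c x| * H.logJ θ v x := by
  simp only [logJ, J_smul]
  ring

theorem logJ_add_le (H : BanachPair E X₀ X₁) (θ : ℝ) (u v : ℝ → H.Inter) (x : ℝ) :
    H.logJ θ (fun x => u x + v x) x ≤ H.logJ θ u x + H.logJ θ v x := by
  rw [logJ, logJ, logJ, ← mul_add]
  exact mul_le_mul_of_nonneg_left (H.J_add_le (Real.exp_pos x).le _ _) (Real.exp_pos _).le

theorem aestronglyMeasurable_fst {H : BanachPair E X₀ X₁} {v : ℝ → H.Inter}
    (hv : AEStronglyMeasurable v) : AEStronglyMeasurable fun x => (v x).1.1 :=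
  (continuous_fst.comp continuous_subtype_val).comp_aestronglyMeasurable hv

theorem aestronglyMeasurable_snd {H : BanachPair E X₀ X₁} {v : ℝ → H.Inter}
    (hv : AEStronglyMeasurable v) : AEStronglyMeasurable fun x => (v x).1.2 :=
  (continuous_snd.comp continuous_subtype_val).comp_aestronglyMeasurable hv

theorem aestronglyMeasurable_logJ {H : BanachPair E X₀ X₁} (θ : ℝ) {v : ℝ → H.Inter}
    (hv : AEStronglyMeasurable v) : AEStronglyMeasurable (H.logJ θ v) := by
  have h0 := (aestronglyMeasurable_fst hv).norm
  have h1 := (aestronglyMeasurable_snd hv).norm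
  have h2 : AEStronglyMeasurable Real.exp := Real.continuous_exp.aestronglyMeasurable
  have h3 : AEStronglyMeasurable fun x : ℝ => Real.exp (-θ * x) :=
    Continuous.aestronglyMeasurable (by fun_prop)
  exact h3.mul (h0.sup (h2.mul h1))

theorem phiJ_eq (H : BanachPair E X₀ X₁) (θ : ℝ) (q : ℝ≥0∞) (u : ℝ → H.Inter) :
    H.PhiJ θ q u = eLpNorm (H.logJ θ fun x => u (Real.exp x)) q := by
  rw [PhiJ, Phi, haarPos_eq_map_exp, measurableEmbedding_exp.eLpNorm_map_measure]
  congr 1 with x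
  simp only [Function.comp, logJ]
  rw [← Real.exp_mul, mul_comm x]

theorem hasIntegral_iff (H : BanachPair E X₀ X₁) (u : ℝ → H.Inter) (f : H.Sum) :
    H.HasIntegral u f ↔ AEStronglyMeasurable (fun x => u (Real.exp x)) ∧
      Integrable (fun x => H.toSumL (u (Real.exp x))) ∧
      ∫ x, H.toSumL (u (Real.exp x)) = f := by
  rw [HasIntegral, haarPos_eq_map_exp, measurableEmbedding_exp.aestronglyMeasurable_map_iff,
    measurableEmbedding_exp.integrable_map_iff, measurableEmbedding_exp.integral_map]
  rfl

/-! ### Decay of the integrand away from a point -/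

section Estimates

variable {H : BanachPair E X₀ X₁} {θ a : ℝ} {q : ℝ≥0∞} {v : ℝ → H.Inter}

/-- To the left of `x` the `X₀`-norm is the good one: `exp (-θ x) = exp (-θ (x - y)) exp (-θ y)`. -/
theorem exp_mul_norm_fst_le (haθ : a ≤ θ) {x y : ℝ} (hyx : y ≤ x) :
    Real.exp (-θ * x) * ‖(v y).1.1‖ ≤ Real.exp (-a * |x - y|) * H.logJ θ v y := by
  rw [logJ, ← mul_assoc, ← Real.exp_add]
  refine mul_le_mul (Real.exp_le_exp.2 ?_) (le_max_left _ _) (norm_nonneg _) (Real.exp_pos _).le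
  rw [abs_of_nonneg (by linarith)]
  nlinarith

/-- To the right of `x` the `X₁`-norm is the good one: the weight `exp ((1 - θ) x)` gains `exp (-(1
- θ) (y - x))` over its value at `y`. -/
theorem exp_mul_norm_snd_le (haθ : a ≤ 1 - θ) {x y : ℝ} (hxy : x ≤ y) :
    Real.exp (-θ * x) * (Real.exp x * ‖(v y).1.2‖) ≤
      Real.exp (-a * |x - y|) * H.logJ θ v y := by
  have h1 : Real.exp (-a * |x - y|) * (Real.exp (-θ * y) * (Real.exp y * ‖(v y).1.2‖)) ≤
      Real.exp (-a * |x - y|) * H.logJ θ v y := by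
    rw [logJ]
    gcongr
    exact le_max_right _ _
  refine le_trans ?_ h1
  simp only [← mul_assoc, ← Real.exp_add]
  refine mul_le_mul_of_nonneg_right (Real.exp_le_exp.2 ?_) (norm_nonneg _)
  rw [abs_of_nonpos (by linarith)]
  nlinarith

theorem norm_toSumL_le (haθ : a ≤ θ) (haθ' : a ≤ 1 - θ) (y : ℝ) :
    ‖H.toSumL (v y)‖ ≤ Real.exp (-a * |y|) * H.logJ θ v y := by
  rcases le_total y 0 with hy | hy
  · have := exp_mul_norm_fst_le (v := v) haθ hy
    rw [toSumL_eq_inl]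
    exact (H.norm_inl_le _).trans (by simpa using this)
  · have := exp_mul_norm_snd_le (v := v) haθ' hy
    rw [toSumL_eq_inr]
    exact (H.norm_inr_le _).trans (by simpa using this)

theorem integrable_smul_toSumL (hθ₀ : 0 < θ) (hθ₁ : θ < 1) (hq : 1 ≤ q)
    (hv : AEStronglyMeasurable v) (hJ : MemLp (H.logJ θ v) q) {c : ℝ → ℝ}
    (hc : AEStronglyMeasurable c) {C : ℝ} {N : ℕ} (hcb : ∀ᵐ x, |c x| ≤ C * (1 + |x|) ^ N) :
    Integrable fun x => c x • H.toSumL (v x) := by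
  set a := min θ (1 - θ)
  have ha : 0 < a := lt_min hθ₀ (by linarith)
  -- Half of the decay rate absorbs the polynomial; the other half keeps the product integrable.
  obtain ⟨D, hD0, hD⟩ := exists_one_add_abs_pow_le N (half_pos ha)
  refine ((integrable_exp_mul_of_memLp (half_pos ha) hq hJ 0).const_mul (|C| * D)).mono'
    (hc.smul (H.toSumL.continuous.comp_aestronglyMeasurable hv)) ?_
  filter_upwards [hcb] with x hx
  rw [norm_smul, Real.norm_eq_abs, zero_sub, abs_neg]
  have h1 : |c x| ≤ |C| * (D * Real.exp (a / 2 * |x|)) :=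
    hx.trans (mul_le_mul (le_abs_self C) (hD x) (by positivity) (abs_nonneg C))
  calc |c x| * ‖H.toSumL (v x)‖
      ≤ (|C| * (D * Real.exp (a / 2 * |x|))) * (Real.exp (-a * |x|) * H.logJ θ v x) :=
        mul_le_mul h1 (norm_toSumL_le (min_le_left _ _) (min_le_right _ _) x) (norm_nonneg _)
          (by positivity)
    _ = |C| * D * ((Real.exp (a / 2 * |x|) * Real.exp (-a * |x|)) * H.logJ θ v x) := by ring
    _ = |C| * D * (Real.exp (-(a / 2) * |x|) * H.logJ θ v x) := by
        rw [← Real.exp_add]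
        congr 4
        ring

theorem integrable_toSumL (hθ₀ : 0 < θ) (hθ₁ : θ < 1) (hq : 1 ≤ q)
    (hv : AEStronglyMeasurable v) (hJ : MemLp (H.logJ θ v) q) :
    Integrable fun x => H.toSumL (v x) := by
  simpa using integrable_smul_toSumL hθ₀ hθ₁ hq hv hJ (c := fun _ => 1)
    aestronglyMeasurable_const (C := 1) (N := 0) (by simp)

theorem integrableOn_fst (hθ₀ : 0 < θ) (hq : 1 ≤ q)
    (hv : AEStronglyMeasurable v) (hJ : MemLp (H.logJ θ v) q) (x : ℝ) :
    IntegrableOn (fun y => (v y).1.1) (Iic x) := by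
  refine ((integrable_exp_mul_of_memLp hθ₀ hq hJ x).const_mul
    (Real.exp (θ * x))).integrableOn.mono' (aestronglyMeasurable_fst hv).restrict ?_
  filter_upwards [ae_restrict_mem measurableSet_Iic] with y hy
  refine le_trans (le_of_eq ?_) (mul_le_mul_of_nonneg_left
    (exp_mul_norm_fst_le (v := v) le_rfl hy) (Real.exp_pos (θ * x)).le)
  rw [← mul_assoc, ← Real.exp_add]
  simp

theorem integrableOn_snd (hθ₁ : θ < 1) (hq : 1 ≤ q)
    (hv : AEStronglyMeasurable v) (hJ : MemLp (H.logJ θ v) q) (x : ℝ) :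
    IntegrableOn (fun y => (v y).1.2) (Ioi x) := by
  refine ((integrable_exp_mul_of_memLp (sub_pos.2 hθ₁) hq hJ x).const_mul
    (Real.exp (-x + θ * x))).integrableOn.mono' (aestronglyMeasurable_snd hv).restrict ?_
  filter_upwards [ae_restrict_mem measurableSet_Ioi] with y hy
  refine le_trans (le_of_eq ?_) (mul_le_mul_of_nonneg_left
    (exp_mul_norm_snd_le (v := v) le_rfl (le_of_lt hy)) (Real.exp_pos (-x + θ * x)).le)
  simp only [← mul_assoc, ← Real.exp_add]
  simp

/-! ### Primitives in the intersection and Hardy's inequality -/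

/-- A function whose values are the two partial integrals `∫_{y ≤ x} v = -∫_{y > x} v` of a function
`v` with vanishing integral, taken in `X₀` and in `X₁` respectively. -/
theorem exists_primitive (hθ₀ : 0 < θ) (hθ₁ : θ < 1) (hq : 1 ≤ q)
    (hv : AEStronglyMeasurable v) (hJ : MemLp (H.logJ θ v) q)
    (h0 : ∫ x, H.toSumL (v x) = 0) :
    ∃ V : ℝ → H.Inter, ∀ x, (V x).1.1 = ∫ y in Iic x, (v y).1.1 ∧
      (V x).1.2 = -∫ y in Ioi x, (v y).1.2 := by
  have hint := integrable_toSumL hθ₀ hθ₁ hq hv hJ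
  have hmem : ∀ x, ((∫ y in Iic x, (v y).1.1), -∫ y in Ioi x, (v y).1.2) ∈ H.interSubmodule := by
    intro x
    -- In the sum, the two candidates differ by the full integral of `v`, which is zero.
    rw [← inl_eq_inr_iff, map_neg,
      ← ContinuousLinearMap.integral_comp_comm _ (integrableOn_fst hθ₀ hq hv hJ x),
      ← ContinuousLinearMap.integral_comp_comm _ (integrableOn_snd hθ₁ hq hv hJ x)]
    simp_rw [← toSumL_eq_inl, ← toSumL_eq_inr]
    rw [← add_eq_zero_iff_eq_neg, ← h0, ← compl_Iic]
    exact integral_add_compl measurableSet_Iic hint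
  exact ⟨fun x => ⟨_, hmem x⟩, fun x => ⟨rfl, rfl⟩⟩

variable {V : ℝ → H.Inter}

theorem toSumL_primitive_Iic (hθ₀ : 0 < θ) (hq : 1 ≤ q)
    (hv : AEStronglyMeasurable v) (hJ : MemLp (H.logJ θ v) q)
    (hV : ∀ x, (V x).1.1 = ∫ y in Iic x, (v y).1.1 ∧ (V x).1.2 = -∫ y in Ioi x, (v y).1.2) (x : ℝ) :
    H.toSumL (V x) = ∫ y in Iic x, H.toSumL (v y) := by
  rw [toSumL_eq_inl, (hV x).1,
    ← ContinuousLinearMap.integral_comp_comm _ (integrableOn_fst hθ₀ hq hv hJ x)]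
  simp_rw [← toSumL_eq_inl]

theorem aestronglyMeasurable_setIntegral_Iic {F : Type*} [NormedAddCommGroup F] [NormedSpace ℝ F]
    {g : ℝ → F} (hg : AEStronglyMeasurable g) :
    AEStronglyMeasurable fun x => ∫ y in Iic x, g y := by
  have hset : MeasurableSet {z : ℝ × ℝ | z.2 ≤ z.1} := measurableSet_le measurable_snd measurable_fst
  have h := ((hg.comp_snd (μ := (volume : Measure ℝ))).indicator hset).integral_prod_right'
  refine h.congr (Filter.Eventually.of_forall fun x => ?_)
  simp only
  rw [← integral_indicator measurableSet_Iic]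
  rfl

theorem aestronglyMeasurable_setIntegral_Ioi {F : Type*} [NormedAddCommGroup F] [NormedSpace ℝ F]
    {g : ℝ → F} (hg : AEStronglyMeasurable g) :
    AEStronglyMeasurable fun x => ∫ y in Ioi x, g y := by
  have hset : MeasurableSet {z : ℝ × ℝ | z.1 < z.2} := measurableSet_lt measurable_fst measurable_snd
  have h := ((hg.comp_snd (μ := (volume : Measure ℝ))).indicator hset).integral_prod_right'
  refine h.congr (Filter.Eventually.of_forall fun x => ?_)
  simp only
  rw [← integral_indicator measurableSet_Ioi]
  rfl

theorem aestronglyMeasurable_primitive (hv : AEStronglyMeasurable v)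
    (hV : ∀ x, (V x).1.1 = ∫ y in Iic x, (v y).1.1 ∧ (V x).1.2 = -∫ y in Ioi x, (v y).1.2) :
    AEStronglyMeasurable V := by
  rw [← Topology.IsEmbedding.subtypeVal.aestronglyMeasurable_comp_iff]
  have h0 := aestronglyMeasurable_setIntegral_Iic (aestronglyMeasurable_fst hv)
  have h1 := (aestronglyMeasurable_setIntegral_Ioi (aestronglyMeasurable_snd hv)).neg
  refine (h0.prodMk h1).congr (Filter.Eventually.of_forall fun x => ?_)
  exact Prod.ext (hV x).1.symm (hV x).2.symm

/-- The `X₀`-component integrates over `y ≤ x` and the `X₁`-component over `y > x`, precisely the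
half-lines on which the respective norm decays; each is enlarged to the whole line. -/
theorem enorm_logJ_primitive_le (hθ₀ : 0 < θ) (hθ₁ : θ < 1) (hq : 1 ≤ q)
    (hJ : MemLp (H.logJ θ v) q)
    (hV : ∀ x, (V x).1.1 = ∫ y in Iic x, (v y).1.1 ∧ (V x).1.2 = -∫ y in Ioi x, (v y).1.2) (x : ℝ) :
    ‖H.logJ θ V x‖ₑ ≤ expConv (min θ (1 - θ)) (H.logJ θ v) x := by
  set a := min θ (1 - θ)
  have ha : 0 < a := lt_min hθ₀ (by linarith)
  have hint := integrable_exp_mul_of_memLp ha hq hJ x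
  have hnn : ∀ y, 0 ≤ Real.exp (-a * |x - y|) * H.logJ θ v y := fun y =>
    mul_nonneg (Real.exp_pos _).le (H.logJ_nonneg θ v y)
  have hconv : expConv a (H.logJ θ v) x =
      ENNReal.ofReal (∫ y, Real.exp (-a * |x - y|) * H.logJ θ v y) := by
    rw [ofReal_integral_eq_lintegral_ofReal hint (Filter.Eventually.of_forall hnn)]
    refine lintegral_congr fun y => ?_
    rw [expKernel, Real.enorm_eq_ofReal (H.logJ_nonneg θ v y),
      ENNReal.ofReal_mul (Real.exp_pos _).le]
  rw [hconv, Real.enorm_eq_ofReal (H.logJ_nonneg θ V x)]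
  refine ENNReal.ofReal_le_ofReal ?_
  rw [logJ, J, mul_max_of_nonneg _ _ (Real.exp_pos _).le, (hV x).1, (hV x).2, norm_neg]
  refine max_le ?_ ?_
  · calc Real.exp (-θ * x) * ‖∫ y in Iic x, (v y).1.1‖
        = ‖∫ y in Iic x, Real.exp (-θ * x) • (v y).1.1‖ := by
          rw [integral_smul, norm_smul, Real.norm_of_nonneg (Real.exp_pos _).le]
      _ ≤ ∫ y in Iic x, Real.exp (-a * |x - y|) * H.logJ θ v y := by
          refine norm_integral_le_of_norm_le hint.integrableOn ?_
          filter_upwards [ae_restrict_mem measurableSet_Iic] with y hy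
          rw [norm_smul, Real.norm_of_nonneg (Real.exp_pos _).le]
          exact exp_mul_norm_fst_le (min_le_left _ _) hy
      _ ≤ _ := setIntegral_le_integral hint (Filter.Eventually.of_forall hnn)
  · calc Real.exp (-θ * x) * (Real.exp x * ‖∫ y in Ioi x, (v y).1.2‖)
        = ‖∫ y in Ioi x, (Real.exp (-θ * x) * Real.exp x) • (v y).1.2‖ := by
          rw [integral_smul, norm_smul, Real.norm_of_nonneg (by positivity), mul_assoc]
      _ ≤ ∫ y in Ioi x, Real.exp (-a * |x - y|) * H.logJ θ v y := by
          refine norm_integral_le_of_norm_le hint.integrableOn ?_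
          filter_upwards [ae_restrict_mem measurableSet_Ioi] with y hy
          rw [norm_smul, Real.norm_of_nonneg (by positivity), mul_assoc]
          exact exp_mul_norm_snd_le (min_le_right _ _) (le_of_lt hy)
      _ ≤ _ := setIntegral_le_integral hint (Filter.Eventually.of_forall hnn)

theorem eLpNorm_logJ_primitive_le (hθ₀ : 0 < θ) (hθ₁ : θ < 1) (hq : 1 ≤ q)
    (hJ : MemLp (H.logJ θ v) q)
    (hV : ∀ x, (V x).1.1 = ∫ y in Iic x, (v y).1.1 ∧ (V x).1.2 = -∫ y in Ioi x, (v y).1.2) :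
    eLpNorm (H.logJ θ V) q ≤ expKernelMass (min θ (1 - θ)) * eLpNorm (H.logJ θ v) q :=
  eLpNorm_le_of_le_expConv (lt_min hθ₀ (by linarith)) hq hJ.1
    (enorm_logJ_primitive_le hθ₀ hθ₁ hq hJ hV)

end Estimates
end BanachPair

/-- Integration by parts on the line against a function `g` with vanishing integral. -/
theorem integral_smul_setIntegral_Iic {F : Type*} [NormedAddCommGroup F] [NormedSpace ℝ F]
    [CompleteSpace F] {φ : ℝ → ℝ} {g : ℝ → F} {C : ℝ} {N : ℕ} (hφ : AEStronglyMeasurable φ)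
    (hφb : ∀ᵐ x, |φ x| ≤ C * (1 + |x|) ^ N) (hg : Integrable g)
    (hgN : Integrable fun x => (1 + |x|) ^ (N + 1) • g x) (h0 : ∫ x, g x = 0) :
    ∫ y, φ y • ∫ x in Iic y, g x = -∫ x, (∫ y in (0 : ℝ)..x, φ y) • g x := by
  -- The signed kernel encodes `∫_{x ≤ y} g` when `y ≤ 0` and the equal quantity `-∫_{x > y} g` when
  -- `y > 0`. Its support lies in `|y| ≤ |x|`, so Fubini applies; integrating `φ` against it in `y`
  -- gives `-∫₀ˣ φ`.
  set κ : ℝ × ℝ → ℝ := fun z =>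
    {z : ℝ × ℝ | z.2 ≤ z.1 ∧ z.1 ≤ 0}.indicator 1 z - {z : ℝ × ℝ | 0 < z.1 ∧ z.1 < z.2}.indicator 1 z
    with hκ
  have hκm : Measurable κ := by
    refine (measurable_one.indicator ?_).sub (measurable_one.indicator ?_)
    · exact (measurableSet_le measurable_snd measurable_fst).inter
        (measurableSet_le measurable_fst measurable_const)
    · exact (measurableSet_lt measurable_const measurable_fst).inter
        (measurableSet_lt measurable_fst measurable_snd)
  have hκ1 : ∀ y x, ‖κ (y, x)‖ₑ ≤ (Icc (-|x|) |x|).indicator 1 y := by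
    intro y x
    by_cases hy : y ∈ Icc (-|x|) |x|
    · rw [indicator_of_mem hy, Pi.one_apply]
      simp only [hκ, indicator_apply, mem_ofPred_eq, Pi.one_apply]
      split_ifs with h1 h2 <;> simp
    · have hz : κ (y, x) = 0 := by
        simp only [hκ, indicator_apply, mem_ofPred_eq, Pi.one_apply]
        rw [if_neg, if_neg, sub_zero]
        · rintro ⟨h1, h2⟩
          exact hy ⟨by linarith [abs_nonneg x], h2.le.trans (le_abs_self x)⟩
        · rintro ⟨h1, h2⟩
          exact hy ⟨by linarith [neg_abs_le x], h2.trans (abs_nonneg x)⟩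
      simp [hz]
  set f : ℝ × ℝ → F := fun z => κ z • φ z.1 • g z.2 with hf
  have hfm : AEStronglyMeasurable f (volume.prod volume) :=
    hκm.aestronglyMeasurable.smul (hφ.comp_fst.smul hg.1.comp_snd)
  have hfint : Integrable f (volume.prod volume) := by
    refine ⟨hfm, ?_⟩
    rw [HasFiniteIntegral, lintegral_prod_symm _ hfm.enorm]
    -- The length `2 |x|` of the support in `y` costs one more power, hence the weight of order `N +
    -- 1`.
    have hbound : ∀ x, ∫⁻ y, ‖f (y, x)‖ₑ ≤
        ENNReal.ofReal (2 * |C|) * ‖(1 + |x|) ^ (N + 1) • g x‖ₑ := by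
      intro x
      calc ∫⁻ y, ‖f (y, x)‖ₑ
          ≤ ∫⁻ y, (Icc (-|x|) |x|).indicator
              (fun _ => ENNReal.ofReal (|C| * (1 + |x|) ^ N) * ‖g x‖ₑ) y := by
            refine lintegral_mono_ae ?_
            filter_upwards [hφb] with y hy
            simp only [hf, enorm_smul]
            refine (mul_le_mul_left (hκ1 y x) _).trans ?_
            by_cases hyx : y ∈ Icc (-|x|) |x|
            · rw [indicator_of_mem hyx, indicator_of_mem hyx, Pi.one_apply, one_mul]
              gcongr
              rw [Real.enorm_eq_ofReal_abs]
              refine ENNReal.ofReal_le_ofReal (hy.trans ?_)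
              have : |y| ≤ |x| := abs_le.2 hyx
              gcongr
              exact le_abs_self C
            · simp [indicator_of_notMem hyx]
        _ = ENNReal.ofReal (|C| * (1 + |x|) ^ N) * ‖g x‖ₑ * ENNReal.ofReal (2 * |x|) := by
            rw [lintegral_indicator measurableSet_Icc, setLIntegral_const, Real.volume_Icc]
            congr 2
            ring
        _ = ENNReal.ofReal (2 * |C| * ((1 + |x|) ^ N * |x|)) * ‖g x‖ₑ := by
            rw [mul_right_comm, ← ENNReal.ofReal_mul (by positivity)]
            congr 2
            ring
        _ ≤ ENNReal.ofReal (2 * |C| * (1 + |x|) ^ (N + 1)) * ‖g x‖ₑ := by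
            gcongr
            rw [pow_succ]
            gcongr
            linarith
        _ = _ := by
            rw [enorm_smul, Real.enorm_eq_ofReal (by positivity),
              ENNReal.ofReal_mul (by positivity), mul_assoc]
    refine (lintegral_mono hbound).trans_lt ?_
    rw [lintegral_const_mul' _ _ ENNReal.ofReal_ne_top]
    exact ENNReal.mul_lt_top ENNReal.ofReal_lt_top hgN.2
  have hG : ∀ y, ∫ x in Iic y, g x = -∫ x in Ioi y, g x := fun y => by
    rw [← add_eq_zero_iff_eq_neg, ← h0, ← compl_Iic]
    exact integral_add_compl measurableSet_Iic hg
  have hx : ∀ y, ∫ x, f (y, x) = φ y • ∫ x in Iic y, g x := by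
    intro y
    rcases le_or_gt y 0 with hy | hy
    · rw [← integral_smul, ← integral_indicator measurableSet_Iic]
      refine integral_congr_ae (Filter.Eventually.of_forall fun x => ?_)
      by_cases hxy : x ≤ y <;> simp [hf, hκ, indicator_apply, hy, hxy, hy.not_gt]
    · rw [hG, smul_neg, ← integral_smul, ← integral_indicator measurableSet_Ioi, ← integral_neg]
      refine integral_congr_ae (Filter.Eventually.of_forall fun x => ?_)
      by_cases hxy : y < x <;> simp [hf, hκ, indicator_apply, hy, hxy, hy.not_ge]
  have hy : ∀ x, ∫ y, f (y, x) = -((∫ y in (0 : ℝ)..x, φ y) • g x) := by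
    intro x
    rcases le_or_gt x 0 with hx0 | hx0
    · rw [intervalIntegral.integral_of_ge hx0, neg_smul, neg_neg, ← integral_Icc_eq_integral_Ioc,
        ← integral_smul_const, ← integral_indicator measurableSet_Icc]
      refine integral_congr_ae (Filter.Eventually.of_forall fun y => ?_)
      have h2 : ¬ (0 < y ∧ y < x) := fun h => by linarith [h.1, h.2]
      by_cases hxy : x ≤ y ∧ y ≤ 0 <;> simp [hf, hκ, indicator_apply, hxy, h2]
    · rw [intervalIntegral.integral_of_le hx0.le, integral_Ioc_eq_integral_Ioo,
        ← integral_smul_const, ← integral_indicator measurableSet_Ioo, ← integral_neg]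
      refine integral_congr_ae (Filter.Eventually.of_forall fun y => ?_)
      have h2 : ¬ (x ≤ y ∧ y ≤ 0) := fun h => by linarith [h.1, h.2]
      by_cases hxy : 0 < y ∧ y < x <;> simp [hf, hκ, indicator_apply, hxy, h2]
  calc ∫ y, φ y • ∫ x in Iic y, g x = ∫ y, ∫ x, f (y, x) := by simp_rw [hx]
    _ = ∫ x, ∫ y, f (y, x) := integral_integral_swap hfint
    _ = _ := by simp_rw [hy]; rw [integral_neg]

/-! ### Functions of polynomial growth -/

/-- `c` is measurable and `|c x| ≤ C (1 + |x|) ^ N` almost everywhere, for some `C` and `N`. -/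
def PolyGrowth (c : ℝ → ℝ) : Prop :=
  AEStronglyMeasurable c ∧ ∃ (C : ℝ) (N : ℕ), 0 ≤ C ∧ ∀ᵐ x, |c x| ≤ C * (1 + |x|) ^ N

theorem PolyGrowth.of_bound {c : ℝ → ℝ} (hc : AEStronglyMeasurable c) {C : ℝ} (hC : 0 ≤ C)
    (hb : ∀ᵐ x, |c x| ≤ C) : PolyGrowth c :=
  ⟨hc, C, 0, hC, by simpa using hb⟩

theorem PolyGrowth.const (C : ℝ) : PolyGrowth fun _ => C :=
  .of_bound aestronglyMeasurable_const (abs_nonneg C) (by simp)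

theorem PolyGrowth.mul {c d : ℝ → ℝ} (hc : PolyGrowth c) (hd : PolyGrowth d) :
    PolyGrowth fun x => c x * d x := by
  obtain ⟨hcm, C, N, hC, hcb⟩ := hc
  obtain ⟨hdm, D, M, hD, hdb⟩ := hd
  refine ⟨hcm.mul hdm, C * D, N + M, mul_nonneg hC hD, ?_⟩
  filter_upwards [hcb, hdb] with x h1 h2
  rw [abs_mul, pow_add]
  calc |c x| * |d x| ≤ (C * (1 + |x|) ^ N) * (D * (1 + |x|) ^ M) :=
        mul_le_mul h1 h2 (abs_nonneg _) (by positivity)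
    _ = _ := by ring

theorem PolyGrowth.sub {c d : ℝ → ℝ} (hc : PolyGrowth c) (hd : PolyGrowth d) :
    PolyGrowth fun x => c x - d x := by
  obtain ⟨hcm, C, N, hC, hcb⟩ := hc
  obtain ⟨hdm, D, M, hD, hdb⟩ := hd
  refine ⟨hcm.sub hdm, C + D, N + M, add_nonneg hC hD, ?_⟩
  filter_upwards [hcb, hdb] with x h1 h2
  have hx : 1 ≤ 1 + |x| := by linarith [abs_nonneg x]
  have h3 : (1 + |x|) ^ N ≤ (1 + |x|) ^ (N + M) := pow_le_pow_right₀ hx (by omega)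
  have h4 : (1 + |x|) ^ M ≤ (1 + |x|) ^ (N + M) := pow_le_pow_right₀ hx (by omega)
  have h5 := mul_le_mul_of_nonneg_left h3 hC
  have h6 := mul_le_mul_of_nonneg_left h4 hD
  have h7 := abs_sub (c x) (d x)
  rw [add_mul]
  linarith

theorem PolyGrowth.pow {c : ℝ → ℝ} (hc : PolyGrowth c) (k : ℕ) : PolyGrowth fun x => c x ^ k := by
  induction k with
  | zero => simpa using PolyGrowth.const 1
  | succ k ih => simpa only [pow_succ] using ih.mul hc

theorem PolyGrowth.neg {c : ℝ → ℝ} (hc : PolyGrowth c) : PolyGrowth fun x => -c x := by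
  simpa using (PolyGrowth.const 0).sub hc

theorem IsProfile.polyGrowth_left {p b : ℝ → ℝ} {B : ℝ} (h : IsProfile p b B) : PolyGrowth p := by
  refine ⟨h.continuous.aestronglyMeasurable, |p 0| + B, 1, add_nonneg (abs_nonneg _) h.nonneg, ?_⟩
  refine Filter.Eventually.of_forall fun x => (h.abs_le x).trans ?_
  have h1 := mul_nonneg (abs_nonneg (p 0)) (abs_nonneg x)
  have h2 := h.nonneg
  rw [pow_one]
  linarith [add_mul (|p 0|) B (1 + |x|), mul_add (|p 0|) 1 (|x|), mul_add B 1 (|x|)]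

theorem IsProfile.polyGrowth_right {p b : ℝ → ℝ} {B : ℝ} (h : IsProfile p b B) : PolyGrowth b :=
  .of_bound h.aestronglyMeasurable h.nonneg h.bound

theorem eLpNorm_le_add_of_le {q : ℝ≥0∞} (hq : 1 ≤ q) {f g h : ℝ → ℝ}
    (hf : AEStronglyMeasurable f) (hg : AEStronglyMeasurable g) (hh : ∀ x, |h x| ≤ f x + g x) :
    eLpNorm h q ≤ eLpNorm f q + eLpNorm g q :=
  (eLpNorm_mono_real hh).trans (eLpNorm_add_le hf hg hq)

namespace BanachPair

variable {E X₀ X₁ : Type*}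
  [AddCommGroup E] [Module ℝ E] [TopologicalSpace E] [IsTopologicalAddGroup E]
  [ContinuousSMul ℝ E] [T2Space E]
  [NormedAddCommGroup X₀] [NormedSpace ℝ X₀] [CompleteSpace X₀]
  [NormedAddCommGroup X₁] [NormedSpace ℝ X₁] [CompleteSpace X₁]
  {H : BanachPair E X₀ X₁} {θ : ℝ} {q : ℝ≥0∞} {v : ℝ → H.Inter}

theorem integrable_polyGrowth_smul (hθ₀ : 0 < θ) (hθ₁ : θ < 1) (hq : 1 ≤ q)
    (hv : AEStronglyMeasurable v) (hJ : MemLp (H.logJ θ v) q) {c : ℝ → ℝ} (hc : PolyGrowth c) :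
    Integrable fun x => c x • H.toSumL (v x) := by
  obtain ⟨hcm, C, N, -, hcb⟩ := hc
  exact integrable_smul_toSumL hθ₀ hθ₁ hq hv hJ hcm hcb

theorem eLpNorm_logJ_smul_le (θ : ℝ) (q : ℝ≥0∞) (v : ℝ → H.Inter) {c : ℝ → ℝ} {C : ℝ}
    (hc : ∀ᵐ x, |c x| ≤ C) :
    eLpNorm (H.logJ θ fun x => c x • v x) q ≤ ENNReal.ofReal C * eLpNorm (H.logJ θ v) q := by
  refine eLpNorm_le_mul_eLpNorm_of_ae_le_mul (hc.mono fun x hx => ?_) q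
  rw [logJ_smul, norm_mul, Real.norm_eq_abs, abs_abs]
  exact mul_le_mul_of_nonneg_right hx (norm_nonneg _)

/-! ### Representations with a given bound -/

/-- `f = ∫ v(x) dx` with `‖exp (-θ x) J(exp x, v x)‖_{L^q} ≤ M`. -/
def HasRepr (H : BanachPair E X₀ X₁) (θ : ℝ) (q : ℝ≥0∞) (f : H.Sum) (M : ℝ≥0∞) : Prop :=
  ∃ v : ℝ → H.Inter, AEStronglyMeasurable v ∧ eLpNorm (H.logJ θ v) q ≤ M ∧
    Integrable (fun x => H.toSumL (v x)) ∧ ∫ x, H.toSumL (v x) = f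

theorem HasRepr.mono {f : H.Sum} {M M' : ℝ≥0∞} (h : H.HasRepr θ q f M) (hM : M ≤ M') :
    H.HasRepr θ q f M' :=
  let ⟨v, hv, hb, hi, hf⟩ := h
  ⟨v, hv, hb.trans hM, hi, hf⟩

theorem HasRepr.zero : H.HasRepr θ q 0 0 := by
  refine ⟨fun _ => 0, aestronglyMeasurable_const, ?_,
    by
      simp only [map_zero]
      exact integrable_zero ℝ H.Sum volume, by simp⟩
  have : H.logJ θ (fun _ => 0) = 0 := by
    funext x
    simp [logJ, J]
  simp [this]

theorem HasRepr.const_smul {f : H.Sum} {M : ℝ≥0∞} (h : H.HasRepr θ q f M) (r : ℝ) :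
    H.HasRepr θ q (r • f) (ENNReal.ofReal |r| * M) := by
  obtain ⟨v, hv, hb, hi, hf⟩ := h
  refine ⟨fun x => r • v x, hv.const_smul r, ?_, ?_, ?_⟩
  · refine (eLpNorm_logJ_smul_le θ q v (c := fun _ => r) (C := |r|) (by simp)).trans ?_
    gcongr
  · simp_rw [map_smul]
    exact hi.smul r
  · simp_rw [map_smul]
    rw [integral_smul, hf]

theorem HasRepr.add (hq : 1 ≤ q) {f g : H.Sum} {M N : ℝ≥0∞} (hf : H.HasRepr θ q f M)
    (hg : H.HasRepr θ q g N) : H.HasRepr θ q (f + g) (M + N) := by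
  obtain ⟨v, hv, hvb, hvi, hvf⟩ := hf
  obtain ⟨u, hu, hub, hui, huf⟩ := hg
  refine ⟨fun x => v x + u x, hv.add hu, ?_, ?_, ?_⟩
  · refine (eLpNorm_le_add_of_le hq (aestronglyMeasurable_logJ θ hv)
      (aestronglyMeasurable_logJ θ hu) fun x => ?_).trans (add_le_add hvb hub)
    rw [abs_of_nonneg (H.logJ_nonneg _ _ _)]
    exact H.logJ_add_le θ v u x
  · simp only [map_add]
    exact Integrable.fun_add (ε' := H.Sum) hvi hui
  · simp only [map_add]
    rw [integral_add hvi hui, hvf, huf]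

theorem HasRepr.sum (hq : 1 ≤ q) {ι : Type*} (s : Finset ι) {f : ι → H.Sum} {M : ι → ℝ≥0∞}
    (h : ∀ i ∈ s, H.HasRepr θ q (f i) (M i)) :
    H.HasRepr θ q (∑ i ∈ s, f i) (∑ i ∈ s, M i) := by
  classical
  induction s using Finset.induction_on with
  | empty => simpa using HasRepr.zero
  | insert i s hi ih =>
    rw [Finset.sum_insert hi, Finset.sum_insert hi]
    exact (h i (Finset.mem_insert_self i s)).add hq
      (ih fun j hj => h j (Finset.mem_insert_of_mem hj))

theorem HasRepr.memInterp_and_normInterp_le {f : H.Sum} {M : ℝ≥0∞} (h : H.HasRepr θ q f M)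
    (hM : M < ∞) : H.MemInterp θ q f ∧ H.normInterp θ q f ≤ M := by
  obtain ⟨v, hv, hb, hi, hf⟩ := h
  have h1 : H.HasIntegral (fun s => v (Real.log s)) f := by
    rw [hasIntegral_iff]
    simpa only [Real.log_exp] using ⟨hv, hi, hf⟩
  have h2 : H.PhiJ θ q (fun s => v (Real.log s)) ≤ M := by
    rw [phiJ_eq]
    simpa only [Real.log_exp] using hb
  exact ⟨⟨_, h1, h2.trans_lt hM⟩, le_trans (iInf_le_of_le _ (iInf_le _ h1)) h2⟩

/-! ### Moments -/

/-- Integration by parts with `p^k b = -(p^(k+1))' / (k + 1)`; the contribution of `p 0 ^ (k + 1)`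
vanishes with `∫ v`. A single `V` serves all `k`, so one step shifts every moment at once. -/
theorem exists_integral_pow_smul_primitive (hθ₀ : 0 < θ) (hθ₁ : θ < 1) (hq : 1 ≤ q)
    {p b : ℝ → ℝ} {B : ℝ} (hp : IsProfile p b B)
    (hv : AEStronglyMeasurable v) (hJ : MemLp (H.logJ θ v) q) (h0 : ∫ x, H.toSumL (v x) = 0) :
    ∃ V : ℝ → H.Inter, AEStronglyMeasurable V ∧
      eLpNorm (H.logJ θ V) q ≤ expKernelMass (min θ (1 - θ)) * eLpNorm (H.logJ θ v) q ∧
      ∀ k : ℕ, ∫ x, (p x ^ k * b x) • H.toSumL (V x) =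
        (k + 1 : ℝ)⁻¹ • ∫ x, p x ^ (k + 1) • H.toSumL (v x) := by
  obtain ⟨V, hV⟩ := exists_primitive hθ₀ hθ₁ hq hv hJ h0
  refine ⟨V, aestronglyMeasurable_primitive hv hV,
    eLpNorm_logJ_primitive_le hθ₀ hθ₁ hq hJ hV, fun k => ?_⟩
  have hint := integrable_toSumL hθ₀ hθ₁ hq hv hJ
  obtain ⟨hφ, C, N, -, hφb⟩ := (hp.polyGrowth_left.pow k).mul hp.polyGrowth_right
  have hpoly : PolyGrowth fun x => (1 + |x|) ^ (N + 1) :=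
    ⟨Continuous.aestronglyMeasurable (by fun_prop), 1, N + 1, zero_le_one,
      Filter.Eventually.of_forall fun x => by rw [one_mul, abs_of_nonneg (by positivity)]⟩
  simp_rw [toSumL_primitive_Iic hθ₀ hq hv hJ hV]
  rw [integral_smul_setIntegral_Iic hφ hφb hint
    (integrable_polyGrowth_smul hθ₀ hθ₁ hq hv hJ hpoly) h0]
  simp_rw [hp.pow_succ_sub k, neg_smul, mul_smul, sub_smul]
  rw [integral_neg, neg_neg, integral_smul,
    integral_sub (integrable_polyGrowth_smul hθ₀ hθ₁ hq hv hJ (hp.polyGrowth_left.pow (k + 1)))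
      (integrable_polyGrowth_smul hθ₀ hθ₁ hq hv hJ (.const (p 0 ^ (k + 1)))), integral_smul, h0,
    smul_zero, sub_zero]

/-- Induction on `n` with the density varying: `v` is replaced by `(n + 1) b V`, whose moments are
those of `v` shifted down by one. Each step costs a factor `(n + 1) A B`, where `A` is the kernel
mass. -/
theorem hasRepr_integral_pow_smul (hθ₀ : 0 < θ) (hθ₁ : θ < 1) (hq : 1 ≤ q)
    {p b : ℝ → ℝ} {B : ℝ} (hp : IsProfile p b B) (n : ℕ) :
    ∀ {v : ℝ → H.Inter}, AEStronglyMeasurable v → MemLp (H.logJ θ v) q →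
      (∀ k < n, ∫ x, p x ^ k • H.toSumL (v x) = 0) →
      H.HasRepr θ q (∫ x, p x ^ n • H.toSumL (v x))
        (n.factorial * expKernelMass (min θ (1 - θ)) ^ n * ENNReal.ofReal B ^ n *
          eLpNorm (H.logJ θ v) q) := by
  induction n with
  | zero =>
    intro v hv hJ _
    exact ⟨v, hv, by simp, integrable_toSumL hθ₀ hθ₁ hq hv hJ, by simp⟩
  | succ n ih =>
    intro v hv hJ hmom
    have h0 : ∫ x, H.toSumL (v x) = 0 := by simpa using hmom 0 n.succ_pos
    obtain ⟨V, hVm, hVb, hVint⟩ :=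
      exists_integral_pow_smul_primitive hθ₀ hθ₁ hq hp hv hJ h0
    have hA : expKernelMass (min θ (1 - θ)) < ∞ :=
      expKernelMass_lt_top (lt_min hθ₀ (by linarith))
    have hbd : eLpNorm (H.logJ θ fun x => ((n + 1 : ℝ) * b x) • V x) q ≤
        ENNReal.ofReal ((n + 1) * B) *
          (expKernelMass (min θ (1 - θ)) * eLpNorm (H.logJ θ v) q) := by
      refine (eLpNorm_logJ_smul_le θ q V (C := (n + 1) * B) ?_).trans (by gcongr)
      filter_upwards [hp.bound] with x hx
      rw [abs_mul, abs_of_nonneg (by positivity : (0 : ℝ) ≤ n + 1)]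
      gcongr
    have hm1 : AEStronglyMeasurable fun x => ((n + 1 : ℝ) * b x) • V x :=
      (hp.aestronglyMeasurable.const_mul _).smul hVm
    have hJ1 : MemLp (H.logJ θ fun x => ((n + 1 : ℝ) * b x) • V x) q :=
      ⟨aestronglyMeasurable_logJ θ hm1, hbd.trans_lt
        (ENNReal.mul_lt_top ENNReal.ofReal_lt_top (ENNReal.mul_lt_top hA hJ.2))⟩
    -- The factor `n + 1` is chosen so that the coefficient is exactly 1 at `k = n`.
    have hmom1 : ∀ k : ℕ, ∫ x, p x ^ k • H.toSumL (((n + 1 : ℝ) * b x) • V x) =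
        ((n + 1 : ℝ) * (k + 1 : ℝ)⁻¹) • ∫ x, p x ^ (k + 1) • H.toSumL (v x) := by
      intro k
      rw [mul_smul, ← hVint k, ← integral_smul]
      refine integral_congr_ae (Filter.Eventually.of_forall fun x => ?_)
      simp only [map_smul, smul_smul]
      congr 1
      ring
    have hn : (n + 1 : ℝ) ≠ 0 := by positivity
    have := ih hm1 hJ1 fun k hk => by rw [hmom1, hmom (k + 1) (by omega), smul_zero]
    rw [hmom1, mul_inv_cancel₀ hn, one_smul] at this
    refine this.mono ?_
    refine (mul_le_mul_right hbd _).trans (le_of_eq ?_)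
    rw [ENNReal.ofReal_mul (by positivity), Nat.factorial_succ,
      show ENNReal.ofReal (n + 1 : ℝ) = ((n + 1 : ℕ) : ℝ≥0∞) by
        rw [← ENNReal.ofReal_natCast]; push_cast; rfl]
    push_cast
    ring

theorem integral_sum_smul_toSumL (hθ₀ : 0 < θ) (hθ₁ : θ < 1) (hq : 1 ≤ q)
    (hv : AEStronglyMeasurable v) (hJ : MemLp (H.logJ θ v) q) {ι : Type*} (s : Finset ι)
    {c : ι → ℝ → ℝ} (hc : ∀ i ∈ s, PolyGrowth (c i)) :
    ∫ x, (∑ i ∈ s, c i x) • H.toSumL (v x) = ∑ i ∈ s, ∫ x, c i x • H.toSumL (v x) := by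
  simp_rw [Finset.sum_smul]
  exact integral_finsetSum s fun i hi =>
    integrable_polyGrowth_smul hθ₀ hθ₁ hq hv hJ (hc i hi)

theorem memLp_logJ_smul (hv : AEStronglyMeasurable v) (hJ : MemLp (H.logJ θ v) q) {c : ℝ → ℝ}
    (hc : AEStronglyMeasurable c) {C : ℝ} (hcb : ∀ᵐ x, |c x| ≤ C) :
    MemLp (H.logJ θ fun x => c x • v x) q :=
  ⟨aestronglyMeasurable_logJ θ (hc.smul hv), (eLpNorm_logJ_smul_le θ q v hcb).trans_lt
    (ENNReal.mul_lt_top ENNReal.ofReal_lt_top hJ.2)⟩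

/-- The mixed moments of degree `n` of `p - b` and `p` vanish. -/
theorem hasRepr_integral_sub_pow_smul_of_degree_eq (hθ₀ : 0 < θ) (hθ₁ : θ < 1) (hq : 1 ≤ q)
    {p b : ℝ → ℝ} {B : ℝ} (hp : IsProfile p b B) (n : ℕ)
    (hv : AEStronglyMeasurable v) (hJ : MemLp (H.logJ θ v) q)
    (hmom : ∀ k < n, ∫ x, p x ^ k • H.toSumL (v x) = 0)
    (hmix : ∀ k, 1 ≤ k → k < n → ∫ x, ((p x - b x) ^ (n - k) * p x ^ k) • H.toSumL (v x) = 0) :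
    H.HasRepr θ q (∫ x, (p x - b x) ^ n • H.toSumL (v x))
      ((1 + n.factorial * expKernelMass (min θ (1 - θ)) ^ n) * ENNReal.ofReal B ^ n *
        eLpNorm (H.logJ θ v) q) := by
  have hpn := hasRepr_integral_pow_smul hθ₀ hθ₁ hq hp n hv hJ hmom
  -- For `n = 0` the two extreme terms of the binomial expansion coincide.
  rcases n.eq_zero_or_pos with rfl | hn
  · simp only [pow_zero] at hpn ⊢
    refine hpn.mono ?_
    gcongr
    simp
  have hcb : ∀ᵐ x, |(-b x) ^ n| ≤ B ^ n := by
    filter_upwards [hp.bound] with x hx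
    rw [abs_pow, abs_neg]
    gcongr
  have hb1 : H.HasRepr θ q (∫ x, (-b x) ^ n • H.toSumL (v x))
      (ENNReal.ofReal (B ^ n) * eLpNorm (H.logJ θ v) q) :=
    ⟨fun x => (-b x) ^ n • v x, (hp.aestronglyMeasurable.neg.pow n).smul hv,
      eLpNorm_logJ_smul_le θ q v hcb,
      (integrable_polyGrowth_smul hθ₀ hθ₁ hq hv hJ (hp.polyGrowth_right.neg.pow n)).congr
        (Filter.Eventually.of_forall fun x => (map_smul H.toSumL _ _).symm),
      by simp only [map_smul]⟩
  have hsplit : ∫ x, (-b x) ^ n • H.toSumL (v x) =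
      (∫ x, (p x - b x) ^ n • H.toSumL (v x)) + (-1 : ℝ) ^ n • ∫ x, p x ^ n • H.toSumL (v x) := by
    have hexp : ∀ x, (-b x) ^ n = ∑ k ∈ Finset.range (n + 1),
        ((-1) ^ k * (n.choose k : ℝ)) * ((p x - b x) ^ (n - k) * p x ^ k) := by
      intro x
      rw [show -b x = -p x + (p x - b x) by ring, add_pow]
      refine Finset.sum_congr rfl fun k _ => ?_
      rw [neg_pow (p x)]
      ring
    simp_rw [hexp]
    rw [integral_sum_smul_toSumL hθ₀ hθ₁ hq hv hJ _ fun k _ => (PolyGrowth.const _).mul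
      (((hp.polyGrowth_left.sub hp.polyGrowth_right).pow (n - k)).mul
        (hp.polyGrowth_left.pow k))]
    simp_rw [mul_smul _ _ (H.toSumL (v _))]
    simp_rw [integral_smul, ← mul_smul _ _ (H.toSumL (v _))]
    obtain ⟨m, rfl⟩ : ∃ m, n = m + 1 := ⟨n - 1, by omega⟩
    -- The ends `k = n` and `k = 0` are split off; every term between them is a vanishing mixed
    -- moment.
    rw [Finset.sum_range_succ, Finset.sum_range_succ', Finset.sum_eq_zero]
    · simp
    · intro k hk
      rw [hmix (k + 1) (by omega) (by have := Finset.mem_range.1 hk; omega), smul_zero]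
  have hfinal : ∫ x, (p x - b x) ^ n • H.toSumL (v x) =
      (∫ x, (-b x) ^ n • H.toSumL (v x)) + (-(-1 : ℝ) ^ n) • ∫ x, p x ^ n • H.toSumL (v x) := by
    rw [hsplit, neg_smul, add_neg_cancel_right]
  rw [hfinal]
  refine (hb1.add hq (hpn.const_smul _)).mono (le_of_eq ?_)
  rw [ENNReal.ofReal_pow hp.nonneg]
  simp only [abs_neg, abs_pow, abs_one, one_pow, ENNReal.ofReal_one]
  ring

/-- The mixed moments of every degree `m < n` of `p - b` and `p` vanish. -/
theorem hasRepr_integral_sub_pow_smul_of_degree_lt (hθ₀ : 0 < θ) (hθ₁ : θ < 1) (hq : 1 ≤ q)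
    {p b : ℝ → ℝ} {B : ℝ} (hp : IsProfile p b B) (n : ℕ)
    (hv : AEStronglyMeasurable v) (hJ : MemLp (H.logJ θ v) q)
    (hmix : ∀ m < n, ∀ k ≤ m, ∫ x, ((p x - b x) ^ (m - k) * p x ^ k) • H.toSumL (v x) = 0) :
    H.HasRepr θ q (∫ x, (p x - b x) ^ n • H.toSumL (v x))
      ((∑ m ∈ Finset.range (n + 1), (n.choose m : ℝ≥0∞) *
        ((n - m).factorial * expKernelMass (min θ (1 - θ)) ^ (n - m))) * ENNReal.ofReal B ^ n *
        eLpNorm (H.logJ θ v) q) := by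
  have hcb : ∀ m : ℕ, ∀ᵐ x, |(-b x) ^ m| ≤ B ^ m := fun m => by
    filter_upwards [hp.bound] with x hx
    rw [abs_pow, abs_neg]
    gcongr
  have hbm : ∀ m : ℕ, AEStronglyMeasurable fun x => (-b x) ^ m :=
    fun m => hp.aestronglyMeasurable.neg.pow m
  -- Writing `-b = (p - b) - p` turns `p^j (-b)^m` into a combination of mixed monomials of degree
  -- `m + j < n`.
  have hzero : ∀ m j : ℕ, m + j < n →
      ∫ x, p x ^ j • H.toSumL ((-b x) ^ m • v x) = 0 := by
    intro m j hmj
    have hexp : ∀ x, p x ^ j • H.toSumL ((-b x) ^ m • v x) = (∑ k ∈ Finset.range (m + 1),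
        ((-1) ^ k * (m.choose k : ℝ)) * ((p x - b x) ^ (m + j - (k + j)) * p x ^ (k + j))) •
          H.toSumL (v x) := by
      intro x
      rw [map_smul, smul_smul, show -b x = -p x + (p x - b x) by ring, add_pow, Finset.mul_sum]
      congr 1
      refine Finset.sum_congr rfl fun k _ => ?_
      rw [neg_pow (p x), Nat.add_sub_add_right]
      ring
    simp_rw [hexp]
    rw [integral_sum_smul_toSumL hθ₀ hθ₁ hq hv hJ _ fun k _ => (PolyGrowth.const _).mul
      (((hp.polyGrowth_left.sub hp.polyGrowth_right).pow (m + j - (k + j))).mul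
        (hp.polyGrowth_left.pow (k + j)))]
    refine Finset.sum_eq_zero fun k hk => ?_
    simp_rw [mul_smul _ _ (H.toSumL (v _))]
    simp_rw [integral_smul, ← mul_smul _ _ (H.toSumL (v _))]
    rw [hmix (m + j) hmj (k + j) (by have := Finset.mem_range.1 hk; omega), smul_zero]
  have hsplit : ∫ x, (p x - b x) ^ n • H.toSumL (v x) = ∑ m ∈ Finset.range (n + 1),
      (n.choose m : ℝ) • ∫ x, p x ^ (n - m) • H.toSumL ((-b x) ^ m • v x) := by
    have hexp : ∀ x, (p x - b x) ^ n = ∑ m ∈ Finset.range (n + 1),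
        (n.choose m : ℝ) * (p x ^ (n - m) * (-b x) ^ m) := by
      intro x
      rw [show p x - b x = -b x + p x by ring, add_pow]
      exact Finset.sum_congr rfl fun m _ => by ring
    simp_rw [hexp]
    rw [integral_sum_smul_toSumL hθ₀ hθ₁ hq hv hJ _ fun m _ => (PolyGrowth.const _).mul
      ((hp.polyGrowth_left.pow (n - m)).mul (hp.polyGrowth_right.neg.pow m))]
    simp_rw [map_smul, mul_smul, integral_smul]
  rw [hsplit, Finset.sum_mul, Finset.sum_mul]
  refine HasRepr.sum hq _ fun m hm => ?_
  have hmn : m ≤ n := Nat.lt_succ_iff.1 (Finset.mem_range.1 hm)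
  -- The density `(-b)^m v` contributes `B^m` and the moment estimate of order `n - m` contributes
  -- `B^(n-m)`, so each summand has the common factor `B^n`.
  have h := (hasRepr_integral_pow_smul hθ₀ hθ₁ hq hp (n - m) ((hbm m).smul hv)
    (memLp_logJ_smul hv hJ (hbm m) (hcb m)) fun j hj => hzero m j (by omega)).const_smul
      (n.choose m : ℝ)
  refine h.mono ?_
  calc _ ≤ ENNReal.ofReal |(n.choose m : ℝ)| * ((n - m).factorial *
        expKernelMass (min θ (1 - θ)) ^ (n - m) * ENNReal.ofReal B ^ (n - m) *
          (ENNReal.ofReal (B ^ m) * eLpNorm (H.logJ θ v) q)) := by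
        gcongr
        exact eLpNorm_logJ_smul_le θ q v (hcb m)
    _ = _ := by
        rw [Nat.abs_cast, ENNReal.ofReal_natCast, ENNReal.ofReal_pow hp.nonneg,
          show ENNReal.ofReal B ^ n = ENNReal.ofReal B ^ (n - m) * ENNReal.ofReal B ^ m by
            rw [← pow_add, Nat.sub_add_cancel hmn]]
        ring

end BanachPair

end JMethod

end

/-! ### Return to the multiplicative variable and choice of the constant -/

open JMethod in
theorem mainTheorem7 (θ : ℝ) (hθ₀ : 0 < θ) (hθ₁ : θ < 1) (q : ℝ≥0∞) (hq : 1 ≤ q) (n : ℕ) :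
    ∃ c : ℝ≥0, ∀ (E : Type*) (H₀ : Type*) (H₁ : Type*)
      [AddCommGroup E] [Module ℝ E] [TopologicalSpace E] [IsTopologicalAddGroup E]
      [ContinuousSMul ℝ E] [T2Space E]
      [NormedAddCommGroup H₀] [NormedSpace ℝ H₀] [CompleteSpace H₀]
      [NormedAddCommGroup H₁] [NormedSpace ℝ H₁] [CompleteSpace H₁]
      (H : BanachPair E H₀ H₁) (w : ℝ → ℝ) (u : ℝ → H.Inter) (f : H.Sum),
      MemW w → AEStronglyMeasurable u haarPos → H.PhiJ θ q u < ∞ →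
      -- (i)
      (H.HasIntegral (fun s => avg w s ^ n • u s) f →
        (∀ k < n, H.HasIntegral (fun s => w s ^ k • u s) 0) →
        (∀ k < n, H.HasIntegral (fun s => avg w s ^ k • u s) 0) →
        H.MemInterp θ q f ∧ H.normInterp θ q f ≤ c * normW w ^ n * H.PhiJ θ q u) ∧
      -- (ii), mixed moments of degree `n`
      (H.HasIntegral (fun s => w s ^ n • u s) f →
        (∀ k < n, H.HasIntegral (fun s => w s ^ k • u s) 0) →
        (∀ k < n, H.HasIntegral (fun s => avg w s ^ k • u s) 0) →
        (∀ k, 1 ≤ k → k < n →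
          H.HasIntegral (fun s => (w s ^ (n - k) * avg w s ^ k) • u s) 0) →
        H.MemInterp θ q f ∧ H.normInterp θ q f ≤ c * normW w ^ n * H.PhiJ θ q u) ∧
      -- (ii), mixed moments of every degree `m < n`
      (H.HasIntegral (fun s => w s ^ n • u s) f →
        (∀ k < n, H.HasIntegral (fun s => w s ^ k • u s) 0) →
        (∀ k < n, H.HasIntegral (fun s => avg w s ^ k • u s) 0) →
        (∀ m < n, ∀ k ≤ m,
          H.HasIntegral (fun s => (w s ^ (m - k) * avg w s ^ k) • u s) 0) →
        H.MemInterp θ q f ∧ H.normInterp θ q f ≤ c * normW w ^ n * H.PhiJ θ q u) := by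
  set A := expKernelMass (min θ (1 - θ)) with hA
  have hAtop : A ≠ ∞ := (expKernelMass_lt_top (lt_min hθ₀ (by linarith))).ne
  -- `c₀` serves (i) and (ii)(a), `c₁` serves (ii)(b); their sum serves all three and depends only
  -- on `θ` and `n`.
  set c₀ : ℝ≥0∞ := 1 + n.factorial * A ^ n with hc₀
  set c₁ : ℝ≥0∞ := ∑ m ∈ Finset.range (n + 1), (n.choose m : ℝ≥0∞) *
    ((n - m).factorial * A ^ (n - m)) with hc₁
  have hfac : ∀ m : ℕ, (m.factorial : ℝ≥0∞) * A ^ m ≠ ∞ := fun m =>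
    ENNReal.mul_ne_top (ENNReal.natCast_ne_top _) (ENNReal.pow_ne_top hAtop)
  have hc₀top : c₀ ≠ ∞ := ENNReal.add_ne_top.2 ⟨ENNReal.one_ne_top, hfac n⟩
  have hc₁top : c₁ ≠ ∞ := ENNReal.sum_ne_top.2 fun m _ =>
    ENNReal.mul_ne_top (ENNReal.natCast_ne_top _) (hfac (n - m))
  have hctop : c₀ + c₁ ≠ ∞ := ENNReal.add_ne_top.2 ⟨hc₀top, hc₁top⟩
  refine ⟨(c₀ + c₁).toNNReal, ?_⟩
  intro E H₀ H₁ _ _ _ _ _ _ _ _ _ _ _ _ H w u f hw hu hΦ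
  rw [ENNReal.coe_toNNReal hctop]
  have hp := hw.isProfile
  have hWtop : normW w ≠ ∞ := hw.2.2.ne
  have hWeq : ENNReal.ofReal (normW w).toReal = normW w := ENNReal.ofReal_toReal hWtop
  have hwpb : ∀ x, avg w (Real.exp x) - osc w (Real.exp x) = w (Real.exp x) := fun x => by
    simp [osc]
  have hv : AEStronglyMeasurable fun x => u (Real.exp x) := by
    rwa [haarPos_eq_map_exp, measurableEmbedding_exp.aestronglyMeasurable_map_iff] at hu
  have hΦeq := H.phiJ_eq θ q u
  have hJ : MemLp (H.logJ θ fun x => u (Real.exp x)) q :=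
    ⟨BanachPair.aestronglyMeasurable_logJ θ hv, hΦeq ▸ hΦ⟩
  have hval : ∀ {c : ℝ → ℝ} {g : H.Sum}, H.HasIntegral (fun s => c s • u s) g →
      ∫ x, c (Real.exp x) • H.toSumL (u (Real.exp x)) = g := fun hc => by
    simpa only [map_smul] using ((H.hasIntegral_iff _ _).1 hc).2.2
  have hconcl : ∀ {d : ℝ≥0∞}, d ≤ c₀ + c₁ →
      H.HasRepr θ q f (d * ENNReal.ofReal (normW w).toReal ^ n *
        eLpNorm (H.logJ θ fun x => u (Real.exp x)) q) →
      H.MemInterp θ q f ∧ H.normInterp θ q f ≤ (c₀ + c₁) * normW w ^ n * H.PhiJ θ q u := by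
    intro d hd hf
    rw [hWeq, ← hΦeq] at hf
    refine (hf.mono (by gcongr)).memInterp_and_normInterp_le ?_
    exact ENNReal.mul_lt_top (ENNReal.mul_lt_top hctop.lt_top (ENNReal.pow_lt_top hWtop.lt_top)) hΦ
  refine ⟨fun hf _ hmom => ?_, fun hf _ hmom hmix => ?_, fun hf _ _ hmix => ?_⟩
  · refine hconcl (d := n.factorial * A ^ n) (le_add_self.trans le_self_add) ?_
    rw [← hval hf]
    exact BanachPair.hasRepr_integral_pow_smul hθ₀ hθ₁ hq hp n hv hJ fun k hk => hval (hmom k hk)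
  · refine hconcl (d := c₀) le_self_add ?_
    have h := BanachPair.hasRepr_integral_sub_pow_smul_of_degree_eq hθ₀ hθ₁ hq hp n hv hJ
      (fun k hk => hval (hmom k hk)) fun k hk hkn => by
        simp only [hwpb]
        exact hval (hmix k hk hkn)
    simp only [hwpb] at h
    rwa [hval hf] at h
  · refine hconcl (d := c₁) le_add_self ?_
    have h := BanachPair.hasRepr_integral_sub_pow_smul_of_degree_lt hθ₀ hθ₁ hq hp n hv hJ
      fun m hm k hk => by
        simp only [hwpb]
        exact hval (hmix m hm k hk)
    simp only [hwpb] at h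
    rwa [hval hf] at h
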